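/- All von Neumann algebras are unital and act on complex Hilbert spaces, with unit the identity operator. A tracial von Neumann algebra is a pair $(A,\tau)$ where $A$ is a von Neumann algebra and $\tau$ is a faithful normal tracial state on $A$; write $|x|_2=\tau(x^*x)^{1/2}$. An embedding of $(A,\tau)$ into $(N,\sigma)$ is a unital injective normal $*$-homomorphism $\pi:A\to N$ with $\sigma\circ\pi=\tau$. Lemma 2.6. Let $(A,\tau)$ be a tracial von Neumann algebra, $A\subseteq B(H)$, and let $F\subseteq A$ be a finite set which generates $A$ as a von Neumann algebra. Suppose that for every $\varepsilon>0$ there exist a tracial von Neumann algebra $(N_\varepsilon,\sigma_\varepsilon)$, an embedding $\pi_\varepsilon$ of $(A,\tau)$ into $(N_\varepsilon,\sigma_\varepsilon)$, and a finite-dimensional $*$-subalgebra $B_\varepsilon\subseteq N_\varepsilon$ containing the unit of $N_\varepsilon$, such that for every $x\in F$ there is $b\in B_\varepsilon$ with $|\pi_\varepsilon(x)-b|_2<\varepsilon$, where $|\cdot|_2$ is the $2$-norm of $\sigma_\varepsilon$. Then $A$ is semidiscrete: there are a directed set $J$ and, for $j\in J$, integers $n_j\in\mathbb N$ and unital completely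 positive maps $\phi_j:A\to M_{n_j}(\mathbb C)$ and $\psi_j:M_{n_j}(\mathbb C)\to A$ such that $\psi_j(\phi_j(x))\to x$ $\sigma$-weakly for every $x\in A$. Consequently $A$ is amenable, i.e. injective: there is a linear map $E:B(H)\to B(H)$ with $E(B(H))\subseteq A$, $E(a)=a$ for all $a\in A$, and $\|E(x)\|\le\|x\|$ for all $x\in B(H)$. -/

import Mathlib

open Filter Topology
open scoped ComplexOrder InnerProductSpace CStarAlgebra

universe u v

namespace VonNeumannAlgebra

section

variable {H : Type*} [NormedAddCommGroup H] [InnerProductSpace ℂ H] [CompleteSpace H]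

/-! ### A von Neumann algebra `M ⊆ B(H)` as an ordered C⋆-algebra -/

instance instSMulMemClass : SMulMemClass (VonNeumannAlgebra H) ℂ (H →L[ℂ] H) where
  smul_mem {s} c _ hx := s.toStarSubalgebra.smul_mem hx c

instance instIsClosed (M : VonNeumannAlgebra H) : IsClosed (M : Set (H →L[ℂ] H)) := by
  rw [← M.centralizer_centralizer]
  exact Set.isClosed_centralizer _

/-- The order on `M` is the one induced by the Loewner order of `B(H)`. -/
instance instStarOrderedRing (M : VonNeumannAlgebra H) : StarOrderedRing M := by
  refine StarOrderedRing.of_nonneg_iff' (fun {x y} hxy z => ?_) (fun x => ⟨fun hx => ?_, ?_⟩)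
  · exact add_le_add_right (α := H →L[ℂ] H) hxy z
  · have hx' : (0 : H →L[ℂ] H) ≤ x := hx
    have hm : cfc (fun t : ℝ => Real.sqrt t) (x : H →L[ℂ] H) ∈ M :=
      cfc_mem (𝕜' := ℂ) _ x.2
    refine ⟨⟨_, hm⟩, Subtype.ext ?_⟩
    have hs : IsSelfAdjoint (cfc (fun t : ℝ => Real.sqrt t) (x : H →L[ℂ] H)) :=
      cfc_predicate _ _
    change (x : H →L[ℂ] H) = star (cfc (fun t : ℝ => Real.sqrt t) (x : H →L[ℂ] H)) * _
    rw [hs.star_eq, ← cfc_mul (fun t : ℝ => Real.sqrt t) (fun t : ℝ => Real.sqrt t)]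
    conv_lhs => rw [← cfc_id' ℝ (x : H →L[ℂ] H)]
    exact cfc_congr fun t ht => (Real.mul_self_sqrt (spectrum_nonneg_of_nonneg hx' ht)).symm
  · rintro ⟨s, rfl⟩
    exact star_mul_self_nonneg (s : H →L[ℂ] H)

/-! ### Generators, normality, traces -/

/-- `F ⊆ M` generates `M`: the smallest von Neumann algebra on `H` that contains `F` is `M`. -/
def IsGeneratedBy (M : VonNeumannAlgebra H) (F : Set M) : Prop :=
  IsLeast {N : VonNeumannAlgebra H | ∀ x ∈ F, (x : H →L[ℂ] H) ∈ N} M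

/-- A normal (that is, `σ`-weakly continuous) linear functional on `M`:
`f x = ∑ ⟪ξₙ, x ηₙ⟫` with `∑ ‖ξₙ‖² < ∞` and `∑ ‖ηₙ‖² < ∞`. -/
def IsNormalFunctional (M : VonNeumannAlgebra H) (f : M →ₗ[ℂ] ℂ) : Prop :=
  ∃ ξ η : ℕ → H, Summable (fun n => ‖ξ n‖ ^ 2) ∧ Summable (fun n => ‖η n‖ ^ 2) ∧
    ∀ x : M, HasSum (fun n => ⟪ξ n, (x : H →L[ℂ] H) (η n)⟫_ℂ) (f x)

/-- `u → x` along `l` in the `σ`-weak topology of `M`, the topology induced by the normal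
linear functionals. -/
def TendstoSigmaWeak (M : VonNeumannAlgebra H) {ι : Type*} (u : ι → M) (l : Filter ι) (x : M) :
    Prop :=
  ∀ f : M →ₗ[ℂ] ℂ, M.IsNormalFunctional f → Tendsto (fun i => f (u i)) l (𝓝 (f x))

/-- `τ` is a faithful normal tracial state on `M`; `(M, τ)` is then a tracial
von Neumann algebra. -/
structure IsTrace (M : VonNeumannAlgebra H) (τ : M →ₗ[ℂ] ℂ) : Prop where
  map_one : τ 1 = 1
  nonneg : ∀ x : M, 0 ≤ τ (star x * x)
  tracial : ∀ x y : M, τ (x * y) = τ (y * x)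
  faithful : ∀ x : M, τ (star x * x) = 0 → x = 0
  normal : M.IsNormalFunctional τ

/-- The `2`-norm `|x|₂ = τ(x⋆x)^{1/2}`. -/
noncomputable def twoNorm {M : VonNeumannAlgebra H} (τ : M →ₗ[ℂ] ℂ) (x : M) : ℝ :=
  Real.sqrt (τ (star x * x)).re

/-- An embedding of `(M, τ)` into `(N, σ)`: a unital (as `→⋆ₐ` is) `⋆`-homomorphism that is
injective, normal (`σ`-weakly continuous), and preserves the traces. -/
structure IsTracialEmbedding {K : Type*} [NormedAddCommGroup K] [InnerProductSpace ℂ K]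
    [CompleteSpace K] {M : VonNeumannAlgebra H} {N : VonNeumannAlgebra K}
    (τ : M →ₗ[ℂ] ℂ) (σ : N →ₗ[ℂ] ℂ) (π : M →⋆ₐ[ℂ] N) : Prop where
  injective : Function.Injective π
  normal : ∀ f : N →ₗ[ℂ] ℂ, N.IsNormalFunctional f →
    M.IsNormalFunctional (f ∘ₗ π.toAlgHom.toLinearMap)
  trace_map : ∀ x : M, σ (π x) = τ x

/-- `M` is amenable, i.e. injective: there is a norm-one projection (conditional expectation)
of `B(H)` onto `M`. -/
def IsAmenable (M : VonNeumannAlgebra H) : Prop :=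
  ∃ E : (H →L[ℂ] H) →ₗ[ℂ] (H →L[ℂ] H),
    (∀ x, E x ∈ M) ∧ (∀ x ∈ M, E x = x) ∧ ∀ x, ‖E x‖ ≤ ‖x‖

end



/-- `M` is semidiscrete: there are nets of unital completely positive maps
`φ j : M → M_{n j}(ℂ)` and `ψ j : M_{n j}(ℂ) → M` such that `ψ j (φ j x) → x`
`σ`-weakly for every `x ∈ M`. -/
def IsSemidiscrete {H : Type u} [NormedAddCommGroup H] [InnerProductSpace ℂ H] [CompleteSpace H]
    (M : VonNeumannAlgebra H) : Prop :=
  ∃ (J : Type u) (_ : Preorder J) (_ : IsDirectedOrder J) (_ : Nonempty J)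
    (n : J → ℕ)
    (φ : ∀ j, M →CP CStarMatrix (Fin (n j)) (Fin (n j)) ℂ)
    (ψ : ∀ j, CStarMatrix (Fin (n j)) (Fin (n j)) ℂ →CP M),
    (∀ j, φ j 1 = 1) ∧ (∀ j, ψ j 1 = 1) ∧
      ∀ x : M, M.TendstoSigmaWeak (fun j => ψ j (φ j x)) atTop x

end VonNeumannAlgebra

/-!
The approximants are finite-dimensional ⋆-subalgebras `B` of tracial algebras `(N, σ)` that
contain `(A, τ)`. The orthogonal projection `E` of `N` onto `B` for the inner product `σ(x⋆ y)` is
a conditional expectation, and it factors through a matrix algebra by unital completely positive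
maps (`IsFaithfulTracialState.exists_factorization`): `N → M_n(ℂ)` compresses left multiplication
to `B ⊆ L²(N)`, and `M_n(ℂ) → N` is `m ↦ ∑ m i j • e i (e j)⋆` for an orthonormal basis `e` of
`B`, normalized by a central element of `B`. Composing with the trace-preserving conditional
expectation `N → A` (`VonNeumannAlgebra.IsTrace.exists_conditionalExpectation`), which comes from
a Radon–Nikodym theorem (`VonNeumannAlgebra.IsTrace.exists_density`), gives `φ : A → M_n(ℂ)` and
`ψ : M_n(ℂ) → A` such that `|ψ (φ x) - x|₂` is at most the 2-norm distance from `x` to `B`.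

As the tolerance tends to `0`, that distance tends to `0` on the generators. It is compatible with
the ⋆-algebra operations and dominated by the 2-norm, and the ⋆-algebra generated by `F` is 2-norm
dense (`VonNeumannAlgebra.IsTrace.exists_adjoin_l2norm_sub_lt`, from the bicommutant argument on
an amplification), so the distance tends to `0` on all of `A`. The maps `ψ ∘ φ` are contractions,
and on bounded sets 2-norm convergence implies `σ`-weak convergence
(`VonNeumannAlgebra.IsTrace.tendsto_of_l2norm`). This is semidiscreteness.

For amenability, the functional on `M_n(A)` that represents `φ` extends to a positive functional
on `M_n(B(H))` (`exists_nonneg_extension`), so that `φ` extends to `Φ : B(H) → M_n(ℂ)`; a limit of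
the contractions `ψ ∘ Φ : B(H) → A` along an ultrafilter is a norm-one projection onto `A`.
-/

/-! ### Positive matrices and complete positivity via a trace -/

/-- The matrix with the given entries. -/
def CStarMatrix.ofFun {m n α : Type*} (f : m → n → α) : CStarMatrix m n α := f

@[simp]
theorem CStarMatrix.ofFun_apply {m n α : Type*} (f : m → n → α) (i : m) (j : n) :
    CStarMatrix.ofFun f i j = f i j := rfl

section Positivity

variable {P C : Type*} [CStarAlgebra P] [PartialOrder P] [StarOrderedRing P]
  [CStarAlgebra C] [PartialOrder C] [StarOrderedRing C]

theorem exists_eq_star_mul_self_of_nonneg {x : C} (hx : 0 ≤ x) : ∃ y, x = star y * y :=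
  CStarAlgebra.nonneg_iff_eq_star_mul_self.1 hx

/-- A self-adjoint `h` is positive as soon as `T (h * b) ≥ 0` for all positive `b`, where `T` is a
faithful positive functional. Testing against `b = (h⁻)²` gives `T ((h⁻)³) ≤ 0`. -/
theorem nonneg_of_forall_faithful_nonneg (T : C →ₗ[ℂ] ℂ)
    (hT : ∀ x, 0 ≤ T (star x * x)) (hfaith : ∀ x, T (star x * x) = 0 → x = 0)
    {h : C} (hsa : IsSelfAdjoint h) (hh : ∀ x, 0 ≤ T (h * (x * star x))) : 0 ≤ h := by
  have hm : 0 ≤ h⁻ := CFC.negPart_nonneg h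
  have hms : star h⁻ = h⁻ := (IsSelfAdjoint.of_nonneg hm).star_eq
  have hs : star (CFC.sqrt h⁻) = CFC.sqrt h⁻ :=
    (IsSelfAdjoint.of_nonneg (CFC.sqrt_nonneg _)).star_eq
  have hsq := CFC.sqrt_mul_sqrt_self h⁻
  have hpm : h⁺ * h⁻ = 0 := CFC.posPart_mul_negPart h
  have hdec : h⁺ - h⁻ = h := CFC.posPart_sub_negPart h
  set m := h⁻ with hmdef
  set s := CFC.sqrt m
  -- Test against `m²`; the cube of `m` is written as `star (s * m) * (s * m)` with `s = √m`.
  have key : h * (m * star m) = -(star (s * m) * (s * m)) := by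
    rw [star_mul, hms, hs, ← hdec, sub_mul, ← mul_assoc, hpm, zero_mul, zero_sub]
    congr 1
    calc m * (m * m) = m * (s * s) * m := by rw [hsq, mul_assoc]
      _ = _ := by simp only [mul_assoc]
  have h1 : T (star (s * m) * (s * m)) = 0 := by
    have := hh m
    rw [key, map_neg, Left.nonneg_neg_iff] at this
    exact le_antisymm this (hT _)
  have h2 : s * m = 0 := hfaith _ h1
  have h3 : star m * m = 0 := by
    rw [hms]
    calc m * m = s * s * m := by rw [hsq]
      _ = 0 := by rw [mul_assoc, h2, mul_zero]
  have h4 : m = 0 := (CStarRing.star_mul_self_eq_zero_iff m).1 h3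
  rw [← hdec, h4, sub_zero]
  exact CFC.posPart_nonneg h

variable {n : Type*} [Fintype n] [DecidableEq n]

/-- The compression `p⋆ X p` of a positive matrix `X` by a column `p` is positive. -/
theorem CStarMatrix.sum_star_mul_mul_nonneg {X : CStarMatrix n n P} (hX : 0 ≤ X) (p : n → P) :
    0 ≤ ∑ i, ∑ j, star (p i) * X i j * p j := by
  obtain ⟨Y, rfl⟩ := exists_eq_star_mul_self_of_nonneg hX
  have : ∑ i, ∑ j, star (p i) * (star Y * Y) i j * p j
      = ∑ m, star (∑ i, Y m i * p i) * ∑ j, Y m j * p j := by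
    simp only [CStarMatrix.mul_apply, CStarMatrix.star_apply, star_sum, star_mul,
      Finset.mul_sum, Finset.sum_mul]
    rw [Finset.sum_comm_cycle]
    refine Finset.sum_congr rfl fun m _ => ?_
    rw [Finset.sum_comm]
    exact Finset.sum_congr rfl fun i _ => Finset.sum_congr rfl fun j _ => by
      simp only [mul_assoc]
  rw [this]
  exact Finset.sum_nonneg fun m _ => star_mul_self_nonneg _

/-- The Gram matrix of a row of elements is positive. -/
theorem CStarMatrix.gram_nonneg (w : n → P) :
    0 ≤ (CStarMatrix.ofFun fun i j => star (w i) * w j : CStarMatrix n n P) := by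
  classical
  rcases isEmpty_or_nonempty n with h | ⟨⟨o⟩⟩
  · exact le_of_eq (by ext i; exact h.elim i)
  · let R : CStarMatrix n n P := CStarMatrix.ofFun fun m j => if m = o then w j else 0
    have : (CStarMatrix.ofFun fun i j => star (w i) * w j : CStarMatrix n n P)
        = star R * R := by
      ext i j
      simp [R, CStarMatrix.mul_apply, CStarMatrix.star_apply,
        apply_ite star]
    rw [this]
    exact star_mul_self_nonneg _

/-- A criterion for complete positivity of `E : P → C` in terms of a faithful tracial positive
functional `τ` on `C`: since `Tr ⊗ τ` is faithful on `M_k(C)`, positivity of `E(X)` can be tested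
against the matrices `x x⋆`, that is, against one column `c` of `x` at a time. -/
theorem completelyPositive_of_trace (τ : C →ₗ[ℂ] ℂ)
    (hpos : ∀ x, 0 ≤ τ (star x * x)) (htr : ∀ x y, τ (x * y) = τ (y * x))
    (hfaith : ∀ x, τ (star x * x) = 0 → x = 0)
    (E : P →ₗ[ℂ] C) (hstar : ∀ x, E (star x) = star (E x))
    (hE : ∀ (k : ℕ) (X : CStarMatrix (Fin k) (Fin k) P) (c : Fin k → C), 0 ≤ X →
      0 ≤ ∑ i, ∑ j, τ (star (c i) * E (X i j) * c j))
    (k : ℕ) (X : CStarMatrix (Fin k) (Fin k) P) (hX : 0 ≤ X) : 0 ≤ X.map E := by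
  let T : CStarMatrix (Fin k) (Fin k) C →ₗ[ℂ] ℂ :=
    { toFun := fun Y => ∑ i, τ (Y i i)
      map_add' := fun Y Z => by simp [Finset.sum_add_distrib]
      map_smul' := fun c Y => by simp [Finset.mul_sum] }
  have hT : ∀ Y, T (star Y * Y) = ∑ i, ∑ j, τ (star (Y j i) * Y j i) := fun Y => by
    simp [T, CStarMatrix.mul_apply, CStarMatrix.star_apply]
  refine nonneg_of_forall_faithful_nonneg T (fun Y => ?_) (fun Y hY => ?_) ?_ (fun x => ?_)
  · rw [hT]
    exact Finset.sum_nonneg fun _ _ => Finset.sum_nonneg fun _ _ => hpos _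
  · rw [hT, Finset.sum_eq_zero_iff_of_nonneg
      (fun _ _ => Finset.sum_nonneg fun _ _ => hpos _)] at hY
    ext i j
    have := hY j (Finset.mem_univ _)
    rw [Finset.sum_eq_zero_iff_of_nonneg (fun _ _ => hpos _)] at this
    exact hfaith _ (this i (Finset.mem_univ _))
  · have hXs : star X = X := (IsSelfAdjoint.of_nonneg hX).star_eq
    change star (X.map E) = X.map E
    ext i j
    rw [CStarMatrix.star_apply, CStarMatrix.map_apply, CStarMatrix.map_apply, ← hstar,
      ← CStarMatrix.star_apply, hXs]
  · have : T (X.map E * (x * star x))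
        = ∑ m, ∑ i, ∑ j, τ (star (x i m) * E (X i j) * x j m) := by
      simp only [T, LinearMap.coe_mk, AddHom.coe_mk, CStarMatrix.mul_apply, Finset.mul_sum,
        CStarMatrix.map_apply, CStarMatrix.star_apply, map_sum]
      rw [Finset.sum_comm_cycle]
      refine Finset.sum_congr rfl fun m _ => Finset.sum_congr rfl fun i _ =>
        Finset.sum_congr rfl fun j _ => ?_
      rw [← mul_assoc, htr, mul_assoc]
    rw [this]
    exact Finset.sum_nonneg fun m _ => hE k X (fun i => x i m) hX

end Positivity

/-! ### Completely positive maps -/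

section CP

variable {P C D : Type*} [CStarAlgebra P] [PartialOrder P] [StarOrderedRing P]
  [CStarAlgebra C] [PartialOrder C] [StarOrderedRing C]
  [CStarAlgebra D] [PartialOrder D] [StarOrderedRing D]

/-- The composition of two completely positive maps. -/
noncomputable def CompletelyPositiveMap.comp (g : C →CP D) (f : P →CP C) : P →CP D where
  toLinearMap := g.toLinearMap ∘ₗ f.toLinearMap
  map_cstarMatrix_nonneg' k M hM :=
    g.map_cstarMatrix_nonneg' k _ (f.map_cstarMatrix_nonneg' k M hM)

@[simp]
theorem CompletelyPositiveMap.comp_apply (g : C →CP D) (f : P →CP C) (x : P) :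
    g.comp f x = g (f x) := rfl

theorem CompletelyPositiveMap.map_star (f : P →CP C) (x : P) : f (star x) = star (f x) :=
  StarHomClass.map_star (PositiveLinearMap.ofClass f : P →ₚ[ℂ] C) x

/-- A unital completely positive map satisfies `f(x)⋆ f(x) ≤ 1` when `x⋆ x ≤ 1`: the matrix
`!![1, x; x⋆, 1]` is positive, and its image is compressed by the column `(-f(x), 1)`. -/
theorem CompletelyPositiveMap.norm_apply_le_one (f : P →CP C) (hf : f 1 = 1) {x : P}
    (hx : ‖x‖ ≤ 1) : ‖f x‖ ≤ 1 := by
  have hxx : star x * x ≤ 1 := by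
    rw [← CStarAlgebra.norm_le_one_iff_of_nonneg _ (star_mul_self_nonneg x),
      CStarRing.norm_star_mul_self]
    nlinarith [norm_nonneg x]
  let X : CStarMatrix (Fin 2) (Fin 2) P := CStarMatrix.ofFun ![![1, x], ![star x, 1]]
  have hX : 0 ≤ X := by
    -- With `1 - x⋆ x = y⋆ y`, the matrix is the sum of the Gram matrices of `(1, x)`, `(0, y)`.
    obtain ⟨y, hy⟩ := CStarAlgebra.nonneg_iff_eq_star_mul_self.1 (sub_nonneg.2 hxx)
    have : X = (CStarMatrix.ofFun fun i j => star (![1, x] i) * ![1, x] j)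
        + (CStarMatrix.ofFun fun i j => star (![0, y] i) * ![0, y] j) := by
      ext i j
      fin_cases i <;> fin_cases j <;> simp [X, ← hy]
    rw [this]
    exact add_nonneg (CStarMatrix.gram_nonneg _) (CStarMatrix.gram_nonneg _)
  have h := CStarMatrix.sum_star_mul_mul_nonneg (f.map_cstarMatrix_nonneg' 2 X hX)
    ![- f x, 1]
  have e : ∀ z, f.toLinearMap z = f z := fun _ => rfl
  simp [X, Fin.sum_univ_two, CStarMatrix.map_apply, e, hf, f.map_star] at h
  rw [← CStarAlgebra.norm_le_one_iff_of_nonneg _ (star_mul_self_nonneg (f x)),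
    CStarRing.norm_star_mul_self] at h
  nlinarith [norm_nonneg (f x)]

theorem CompletelyPositiveMap.norm_apply_le (f : P →CP C) (hf : f 1 = 1) (x : P) :
    ‖f x‖ ≤ ‖x‖ := by
  rcases eq_or_ne x 0 with rfl | hx
  · simp
  have hx' : (0 : ℝ) < ‖x‖ := norm_pos_iff.2 hx
  have h := f.norm_apply_le_one hf (x := ((‖x‖⁻¹ : ℝ) : ℂ) • x) (by
    rw [norm_smul]; simp [hx'.ne'])
  rw [map_smul, norm_smul] at h
  simp only [Complex.norm_real, norm_inv, norm_norm] at h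
  rwa [inv_mul_le_iff₀ hx', mul_one] at h

end CP

/-! ### Completely positive maps from and to matrix algebras -/

theorem Finset.sum_sum_comm {α β γ δ M : Type*} [AddCommMonoid M] [Fintype α] [Fintype β]
    [Fintype γ] [Fintype δ] (f : α → β → γ → δ → M) :
    ∑ a, ∑ b, ∑ c, ∑ d, f a b c d = ∑ c, ∑ d, ∑ a, ∑ b, f a b c d := by
  simpa only [Fintype.sum_prod_type] using
    Finset.sum_comm (s := (Finset.univ : Finset (α × β))) (t := (Finset.univ : Finset (γ × δ)))
      (f := fun x y => f x.1 x.2 y.1 y.2)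

theorem LinearMap.map_star_of_nonneg {C : Type*} [CStarAlgebra C] [PartialOrder C]
    [StarOrderedRing C] (s : C →ₗ[ℂ] ℂ) (hs : ∀ x, 0 ≤ x → 0 ≤ s x) (x : C) :
    s (star x) = star (s x) :=
  StarHomClass.map_star (PositiveLinearMap.mk₀ s hs) x

namespace CStarMatrix

theorem sum_apply {ι m n α : Type*} [AddCommMonoid α] (t : Finset ι)
    (f : ι → CStarMatrix m n α) (i : m) (j : n) : (∑ x ∈ t, f x) i j = ∑ x ∈ t, f x i j :=
  map_sum (⟨⟨fun M => M i j, rfl⟩, fun _ _ => rfl⟩ : CStarMatrix m n α →+ α) f t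

section MatrixMaps

variable {n : ℕ} {P : Type*} [CStarAlgebra P]

/-- The linear map underlying `CStarMatrix.ofVectors`. -/
noncomputable def ofVectorsLinear (g : Fin n → P) : CStarMatrix (Fin n) (Fin n) ℂ →ₗ[ℂ] P where
  toFun m := ∑ i, ∑ j, m i j • (g i * star (g j))
  map_add' x y := by simp [add_smul, Finset.sum_add_distrib]
  map_smul' c x := by simp [Finset.smul_sum, smul_smul]

theorem ofVectorsLinear_apply (g : Fin n → P) (m : CStarMatrix (Fin n) (Fin n) ℂ) :
    ofVectorsLinear g m = ∑ i, ∑ j, m i j • (g i * star (g j)) := rfl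

/-- The matrix with `x` in position `(i, j)` and zeros elsewhere. -/
def entry (i j : Fin n) : P →ₗ[ℂ] CStarMatrix (Fin n) (Fin n) P where
  toFun x := ofFun fun a b => if a = i ∧ b = j then x else 0
  map_add' x y := by ext a b; simp only [add_apply, ofFun_apply]; split_ifs <;> simp
  map_smul' c x := by
    ext a b
    simp only [smul_apply, ofFun_apply, RingHom.id_apply]
    split_ifs <;> simp

theorem entry_apply (i j a b : Fin n) (x : P) :
    entry i j x a b = if a = i ∧ b = j then x else 0 := rfl

theorem sum_entry (X : CStarMatrix (Fin n) (Fin n) P) : ∑ i, ∑ j, entry i j (X i j) = X := by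
  ext a b
  simp [sum_apply, entry_apply, ite_and]

theorem star_entry (i j : Fin n) (x : P) : star (entry i j x) = entry j i (star x) := by
  ext a b
  simp only [star_apply, entry_apply, and_comm (a := b = i)]
  split_ifs <;> simp

/-- The linear map underlying `CStarMatrix.ofFunctional`. -/
noncomputable def ofFunctionalLinear (s : CStarMatrix (Fin n) (Fin n) P →ₗ[ℂ] ℂ) :
    P →ₗ[ℂ] CStarMatrix (Fin n) (Fin n) ℂ where
  toFun x := ofFun fun i j => s (entry i j x)
  map_add' x y := by ext i j; simp
  map_smul' c x := by ext i j; simp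

/-- The unnormalized trace of a complex matrix. -/
noncomputable def tr : CStarMatrix (Fin n) (Fin n) ℂ →ₗ[ℂ] ℂ where
  toFun m := ∑ i, m i i
  map_add' x y := by simp [Finset.sum_add_distrib]
  map_smul' c x := by simp [Finset.mul_sum]

theorem tr_apply (m : CStarMatrix (Fin n) (Fin n) ℂ) : tr m = ∑ i, m i i := rfl

theorem tr_star_mul_self (m : CStarMatrix (Fin n) (Fin n) ℂ) :
    tr (star m * m) = ∑ i, ∑ j, star (m j i) * m j i := by
  simp [tr_apply, mul_apply, star_apply]

variable [PartialOrder P] [StarOrderedRing P]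

/-- The completely positive map `M_n(ℂ) → P`, `m ↦ ∑ m i j • g i (g j)⋆`, of a row `g` of elements
of `P`. -/
noncomputable def ofVectors (g : Fin n → P) : CStarMatrix (Fin n) (Fin n) ℂ →CP P where
  toLinearMap := ofVectorsLinear g
  map_cstarMatrix_nonneg' k X hX := by
    obtain ⟨D, rfl⟩ := exists_eq_star_mul_self_of_nonneg hX
    -- For `X = D⋆ D` the image of `X` is a sum of Gram matrices, one for each row `(p, q)` of `D`.
    have : (star D * D).map (ofVectorsLinear g) = ∑ p, ∑ q,
        (ofFun fun a b => star (∑ i, D p a q i • star (g i)) * ∑ j, D p b q j • star (g j) :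
          CStarMatrix (Fin k) (Fin k) P) := by
      ext a b
      simp only [sum_apply, map_apply, ofFun_apply, ofVectorsLinear_apply, mul_apply, star_apply,
        star_sum, star_smul, star_star, Finset.sum_mul_sum, Finset.sum_smul, smul_mul_smul_comm]
      calc _ = ∑ i, ∑ p, ∑ q, ∑ j, (star (D p a q i) * D p b q j) • (g i * star (g j)) := by
            refine Finset.sum_congr rfl fun i _ => ?_
            rw [Finset.sum_comm]
            refine Finset.sum_congr rfl fun p _ => ?_
            rw [Finset.sum_comm]
        _ = _ := by
            rw [Finset.sum_comm]
            refine Finset.sum_congr rfl fun p _ => ?_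
            rw [Finset.sum_comm]
    rw [this]
    exact Finset.sum_nonneg fun p _ => Finset.sum_nonneg fun q _ => gram_nonneg _

theorem ofVectors_apply (g : Fin n → P) (m : CStarMatrix (Fin n) (Fin n) ℂ) :
    ofVectors g m = ∑ i, ∑ j, m i j • (g i * star (g j)) := rfl

/-- The completely positive map `P → M_n(ℂ)` with entries `s (x ⊗ e i j)`, for a positive functional
`s` on `M_n(P)`. Every completely positive map into `M_n(ℂ)` is of this form. -/
noncomputable def ofFunctional (s : CStarMatrix (Fin n) (Fin n) P →ₗ[ℂ] ℂ)
    (hs : ∀ X, 0 ≤ X → 0 ≤ s X) : P →CP CStarMatrix (Fin n) (Fin n) ℂ where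
  toLinearMap := ofFunctionalLinear s
  map_cstarMatrix_nonneg' := by
    refine completelyPositive_of_trace tr (fun x => ?_) (fun x y => ?_) (fun x hx => ?_) _
      (fun x => ?_) (fun k X c hX => ?_)
    · rw [tr_star_mul_self]
      exact Finset.sum_nonneg fun _ _ => Finset.sum_nonneg fun _ _ => star_mul_self_nonneg _
    · simp only [tr_apply, mul_apply]
      rw [Finset.sum_comm]
      simp only [mul_comm]
    · rw [tr_star_mul_self, Finset.sum_eq_zero_iff_of_nonneg
        (fun _ _ => Finset.sum_nonneg fun _ _ => star_mul_self_nonneg _)] at hx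
      ext i j
      have := hx j (Finset.mem_univ _)
      rw [Finset.sum_eq_zero_iff_of_nonneg (fun _ _ => star_mul_self_nonneg _)] at this
      exact (CStarRing.star_mul_self_eq_zero_iff _).1 (this i (Finset.mem_univ _))
    · ext i j
      have := s.map_star_of_nonneg hs (entry j i x)
      rw [star_entry] at this
      exact this
    · obtain ⟨Y, rfl⟩ := exists_eq_star_mul_self_of_nonneg hX
      -- By `X = Y⋆ Y` the tested quantity is a sum of values of `s` at Gram matrices, one for
      -- each column index `q` of `c` and row index `p` of `Y`.
      have key : ∑ a, ∑ b, tr (star (c a) * ofFunctionalLinear s ((star Y * Y) a b) * c b)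
          = ∑ q, ∑ p, s (ofFun fun i j => star (∑ a, c a i q • Y p a) * ∑ b, c b j q • Y p b) := by
        have e1 : ∀ q p, s (ofFun fun i j => star (∑ a, c a i q • Y p a) * ∑ b, c b j q • Y p b)
            = ∑ i, ∑ j, ∑ a, ∑ b,
              star (c a i q) * c b j q * s (entry i j (star (Y p a) * Y p b)) := by
          intro q p
          rw [← sum_entry (ofFun _)]
          simp only [ofFun_apply, star_sum, star_smul, Finset.sum_mul_sum, smul_mul_smul_comm,
            map_sum, map_smul, smul_eq_mul]
        have e2 : ∀ a b, tr (star (c a) * ofFunctionalLinear s ((star Y * Y) a b) * c b)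
            = ∑ q, ∑ p, ∑ i, ∑ j,
              star (c a i q) * c b j q * s (entry i j (star (Y p a) * Y p b)) := by
          intro a b
          simp only [tr_apply, mul_apply, star_apply, ofFunctionalLinear, LinearMap.coe_mk,
            AddHom.coe_mk, ofFun_apply, map_sum, Finset.sum_mul, Finset.mul_sum]
          rw [Finset.sum_comm]
          refine Finset.sum_congr rfl fun q _ => Finset.sum_congr rfl fun p _ => ?_
          rw [Finset.sum_comm]
          exact Finset.sum_congr rfl fun i _ => Finset.sum_congr rfl fun j _ => by ring
        simp only [e1, e2]
        rw [Finset.sum_sum_comm]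
        exact Finset.sum_congr rfl fun q _ => Finset.sum_congr rfl fun p _ =>
          Finset.sum_sum_comm _
      rw [key]
      exact Finset.sum_nonneg fun q _ => Finset.sum_nonneg fun p _ => hs _ (gram_nonneg _)

theorem ofFunctional_apply (s : CStarMatrix (Fin n) (Fin n) P →ₗ[ℂ] ℂ)
    (hs : ∀ X, 0 ≤ X → 0 ≤ s X) (x : P) (i j : Fin n) :
    ofFunctional s hs x i j = s (entry i j x) := rfl

end MatrixMaps

end CStarMatrix

/-! ### Extension of positive functionals -/

section Extension

open scoped ComplexStarModule

variable {C P : Type*} [CStarAlgebra C] [PartialOrder C] [StarOrderedRing C]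
  [CStarAlgebra P] [PartialOrder P] [StarOrderedRing P]

/-- An injective ⋆-homomorphism reflects positivity of self-adjoint elements: `ι(h⁻ h h⁻)` is
positive, while `h⁻ h h⁻ = -(h⁻)³` is negative. -/
theorem nonneg_of_map_nonneg_of_injective (ι : C →⋆ₙₐ[ℂ] P) (hinj : Function.Injective ι) {h : C}
    (hsa : IsSelfAdjoint h) (hh : 0 ≤ ι h) : 0 ≤ h := by
  have hm : 0 ≤ h⁻ := CFC.negPart_nonneg h
  have hms : star h⁻ = h⁻ := (IsSelfAdjoint.of_nonneg hm).star_eq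
  have hpm : h⁺ * h⁻ = 0 := CFC.posPart_mul_negPart h
  have hdec : h⁺ - h⁻ = h := CFC.posPart_sub_negPart h
  have hcube : 0 ≤ star h⁻ * h⁻ * h⁻ := star_left_conjugate_nonneg hm _
  have e : star h⁻ * h * h⁻ = -(star h⁻ * h⁻ * h⁻) := by
    have : h * h⁻ = -(h⁻ * h⁻) := by
      nth_rewrite 1 [← hdec]
      rw [sub_mul, hpm, zero_sub]
    rw [mul_assoc, this, mul_neg, mul_assoc]
  have h1 : 0 ≤ ι (star h⁻ * h * h⁻) := by
    rw [map_mul, map_mul, map_star]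
    exact star_left_conjugate_nonneg hh _
  rw [e, map_neg, Left.nonneg_neg_iff] at h1
  have h2 : star h⁻ * h⁻ * h⁻ = 0 :=
    hinj ((le_antisymm h1 (map_nonneg ι hcube)).trans (map_zero ι).symm)
  have h3 : h⁻ * h⁻ = 0 := by
    rw [← CStarRing.star_mul_self_eq_zero_iff, star_mul, hms]
    calc h⁻ * h⁻ * (h⁻ * h⁻) = h⁻ * (star h⁻ * h⁻ * h⁻) := by rw [hms]; simp only [mul_assoc]
      _ = 0 := by rw [h2, mul_zero]
  have h4 : h⁻ = 0 := by
    rw [← CStarRing.star_mul_self_eq_zero_iff, hms, h3]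
  rw [← hdec, h4, sub_zero]
  exact CFC.posPart_nonneg h

/-- A positive functional on a unital C⋆-subalgebra extends to a positive functional on the whole
algebra. On the real space of self-adjoint elements this is the M. Riesz extension theorem, whose
cofinality hypothesis holds because `-y ≤ ‖y‖`; the extension is then complexified. -/
theorem exists_nonneg_extension (ι : C →⋆ₙₐ[ℂ] P) (hinj : Function.Injective ι) (hone : ι 1 = 1)
    (s : C →ₗ[ℂ] ℂ) (hs : ∀ x, 0 ≤ x → 0 ≤ s x) :
    ∃ s' : P →ₗ[ℂ] ℂ, (∀ x, 0 ≤ x → 0 ≤ s' x) ∧ ∀ x, s' (ι x) = s x := by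
  have hre : ∀ x : selfAdjoint C, ((s x).re : ℂ) = s x := fun x => by
    rw [← Complex.conj_eq_iff_re, ← Complex.star_def, ← s.map_star_of_nonneg hs, x.2.star_eq]
  let L : selfAdjoint C →ₗ[ℝ] selfAdjoint P :=
    { toFun := fun x => ⟨ι x, x.2.map ι⟩
      map_add' := fun x y => Subtype.ext (by simp)
      map_smul' := fun r x => Subtype.ext (by
        simp only [selfAdjoint.val_smul, RingHom.id_apply]
        rw [← Complex.coe_smul, map_smul, Complex.coe_smul]) }
  have hL : Function.Injective L := fun x y hxy =>
    Subtype.ext (hinj (congrArg Subtype.val hxy))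
  let e := LinearEquiv.ofInjective L hL
  let f₀ : selfAdjoint C →ₗ[ℝ] ℝ :=
    { toFun := fun x => (s x).re
      map_add' := fun x y => by simp
      map_smul' := fun r x => by
        simp only [selfAdjoint.val_smul, RingHom.id_apply]
        rw [← Complex.coe_smul, map_smul]
        simp }
  -- The partially defined functional on the self-adjoint elements of the subalgebra.
  let f : selfAdjoint P →ₗ.[ℝ] ℝ := ⟨L.range, f₀ ∘ₗ e.symm.toLinearMap⟩
  have hf : ∀ (x : selfAdjoint C) (hx : L x ∈ f.domain), f ⟨L x, hx⟩ = f₀ x := fun x hx => by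
    change f₀ (e.symm ⟨L x, hx⟩) = f₀ x
    congr 1
    rw [LinearEquiv.symm_apply_eq]
    rfl
  let cone : PointedCone ℝ (selfAdjoint P) :=
    { carrier := {x | (0 : P) ≤ x}
      add_mem' := fun {x y} hx hy => add_nonneg (α := P) hx hy
      zero_mem' := le_refl (0 : P)
      smul_mem' := fun c x hx => smul_nonneg (α := ℝ) (β := P) c.2 hx }
  obtain ⟨g, hg, hgpos⟩ := riesz_extension cone f (by
    rintro ⟨_, ⟨x, rfl⟩⟩ hx
    refine le_of_le_of_eq ?_ (hf x ⟨x, rfl⟩).symm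
    have : (0 : C) ≤ x := nonneg_of_map_nonneg_of_injective ι hinj x.2 hx
    exact (Complex.le_def.1 (hs _ this)).1) (by
    intro y
    refine ⟨⟨L (‖(y : P)‖ • 1), ⟨_, rfl⟩⟩, ?_⟩
    change (0 : P) ≤ ι ((‖(y : P)‖ • (1 : selfAdjoint C) : selfAdjoint C) : C) + y
    have h1 := IsSelfAdjoint.neg_algebraMap_norm_le_self y.2
    rw [selfAdjoint.val_smul, ← Complex.coe_smul, map_smul, selfAdjoint.val_one, hone,
      Complex.coe_smul, ← Algebra.algebraMap_eq_smul_one]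
    rw [← sub_nonneg] at h1
    simpa [add_comm] using h1)
  let s' : P →ₗ[ℂ] ℂ :=
    { toFun := fun x => (g (ℜ x) : ℂ) + Complex.I * g (ℑ x)
      map_add' := fun x y => by simp; ring
      map_smul' := fun c x => by
        rw [realPart_smul, imaginaryPart_smul]
        apply Complex.ext <;> simp }
  have hs' : ∀ x, s' x = (g (ℜ x) : ℂ) + Complex.I * g (ℑ x) := fun _ => rfl
  have hgs : ∀ x : selfAdjoint C, (g (L x) : ℂ) = s x := fun x => by
    rw [← hre]
    exact congrArg _ ((hg ⟨L x, ⟨x, rfl⟩⟩).trans (hf x ⟨x, rfl⟩))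
  refine ⟨s', fun x hx => ?_, fun x => ?_⟩
  · have hxs : IsSelfAdjoint x := .of_nonneg hx
    rw [hs', hxs.imaginaryPart]
    have := hgpos (ℜ x) (by change (0 : P) ≤ ℜ x; rwa [hxs.coe_realPart])
    simpa using this
  · have h1 : ℜ (ι x) = L (ℜ x) := Subtype.ext (map_realPart ι x).symm
    have h2 : ℑ (ι x) = L (ℑ x) := Subtype.ext (map_imaginaryPart ι x).symm
    rw [hs', h1, h2, hgs, hgs, ← smul_eq_mul, ← map_smul, ← map_add,
      realPart_add_I_smul_imaginaryPart]

end Extension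

/-! ### The 2-norm of a faithful tracial state -/

section L2

variable {C : Type*} [CStarAlgebra C]

/-- The seminorm `τ(x⋆x)^{1/2}` of a positive functional `τ` on a C⋆-algebra. On a von Neumann
algebra it unfolds to the same expression as `VonNeumannAlgebra.twoNorm`. -/
noncomputable def l2norm (τ : C →ₗ[ℂ] ℂ) (x : C) : ℝ := √(τ (star x * x)).re

theorem l2norm_nonneg (τ : C →ₗ[ℂ] ℂ) (x : C) : 0 ≤ l2norm τ x := Real.sqrt_nonneg _

theorem l2norm_neg (τ : C →ₗ[ℂ] ℂ) (x : C) : l2norm τ (-x) = l2norm τ x := by simp [l2norm]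

/-- A faithful tracial state on a unital C⋆-algebra; no normality is required. -/
structure IsFaithfulTracialState (τ : C →ₗ[ℂ] ℂ) : Prop where
  map_one : τ 1 = 1
  star_mul_self_nonneg : ∀ x, 0 ≤ τ (star x * x)
  tracial : ∀ x y, τ (x * y) = τ (y * x)
  faithful : ∀ x, τ (star x * x) = 0 → x = 0

namespace IsFaithfulTracialState

variable {τ : C →ₗ[ℂ] ℂ} (hτ : IsFaithfulTracialState τ)
include hτ

theorem re_nonneg (x : C) : 0 ≤ (τ (star x * x)).re :=
  (Complex.le_def.1 (hτ.star_mul_self_nonneg x)).1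

theorem l2norm_sq (x : C) : l2norm τ x ^ 2 = (τ (star x * x)).re :=
  Real.sq_sqrt (hτ.re_nonneg x)

theorem l2norm_star (x : C) : l2norm τ (star x) = l2norm τ x := by
  rw [l2norm, l2norm, star_star, hτ.tracial]

variable [PartialOrder C] [StarOrderedRing C]

theorem nonneg {x : C} (hx : 0 ≤ x) : 0 ≤ τ x := by
  obtain ⟨y, rfl⟩ := exists_eq_star_mul_self_of_nonneg hx
  exact hτ.star_mul_self_nonneg y

theorem mono {x y : C} (hxy : x ≤ y) : τ x ≤ τ y := by
  rw [← sub_nonneg, ← map_sub]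
  exact hτ.nonneg (sub_nonneg.2 hxy)

theorem map_star (x : C) : τ (star x) = star (τ x) :=
  τ.map_star_of_nonneg (fun _ => hτ.nonneg) x

/-- The Cauchy–Schwarz inequality. -/
theorem norm_map_star_mul_le (x y : C) : ‖τ (star x * y)‖ ≤ l2norm τ x * l2norm τ y :=
  let f : C →ₚ[ℂ] ℂ := .mk₀ τ fun _ => hτ.nonneg
  norm_inner_le_norm (𝕜 := ℂ) (f.toPreGNS x) (f.toPreGNS y)

theorem l2norm_add_le (x y : C) : l2norm τ (x + y) ≤ l2norm τ x + l2norm τ y :=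
  let f : C →ₚ[ℂ] ℂ := .mk₀ τ fun _ => hτ.nonneg
  norm_add_le (f.toPreGNS x) (f.toPreGNS y)

theorem l2norm_smul (c : ℂ) (x : C) : l2norm τ (c • x) = ‖c‖ * l2norm τ x :=
  let f : C →ₚ[ℂ] ℂ := .mk₀ τ fun _ => hτ.nonneg
  norm_smul c (f.toPreGNS x)

theorem l2norm_mul_le (x y : C) : l2norm τ (x * y) ≤ ‖x‖ * l2norm τ y := by
  refine abs_le_of_sq_le_sq' ?_ (by have := l2norm_nonneg τ y; positivity) |>.2
  have h1 : star x * x ≤ algebraMap ℝ C (‖x‖ ^ 2) := by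
    rw [pow_two, ← CStarRing.norm_star_mul_self]
    exact IsSelfAdjoint.le_algebraMap_norm_self (.star_mul_self x)
  have h2 := hτ.mono (star_left_conjugate_le_conjugate h1 y)
  have h3 := (Complex.le_def.1 h2).1
  rw [mul_pow, hτ.l2norm_sq, hτ.l2norm_sq]
  have e1 : star y * (star x * x) * y = star (x * y) * (x * y) := by
    rw [star_mul]; simp only [mul_assoc]
  have e2 : star y * algebraMap ℝ C (‖x‖ ^ 2) * y = ((‖x‖ ^ 2 : ℝ) : ℂ) • (star y * y) := by
    rw [Algebra.algebraMap_eq_smul_one, Complex.coe_smul]; simp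
  rw [e1, e2, map_smul, smul_eq_mul, Complex.re_ofReal_mul] at h3
  exact h3

/-- By traciality, the 2-norm also satisfies the module bound on the right. -/
theorem l2norm_mul_le' (x y : C) : l2norm τ (x * y) ≤ l2norm τ x * ‖y‖ := by
  rw [← hτ.l2norm_star, star_mul, mul_comm, ← hτ.l2norm_star x, ← norm_star]
  exact hτ.l2norm_mul_le _ _

end IsFaithfulTracialState

end L2

/-- A finite-dimensional inner product space, given by its core, has an orthonormal basis that
contains a prescribed unit vector. -/
theorem exists_orthonormalBasis_of_core {V : Type*} [AddCommGroup V] [Module ℂ V]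
    [FiniteDimensional ℂ V] (ip : InnerProductSpace.Core ℂ V) (u : V) (hu : ip.inner u u = 1) :
    ∃ (n : ℕ) (e : Fin n → V), (∀ i j, ip.inner (e i) (e j) = if i = j then 1 else 0) ∧
      (∀ v, v = ∑ i, ip.inner (e i) v • e i) ∧ ∃ i, e i = u := by
  classical
  let _ : NormedAddCommGroup V := ip.toNormedAddCommGroup
  let _ : InnerProductSpace ℂ V := InnerProductSpace.ofCore ip.toCore
  have hin : ∀ x y : V, ip.inner x y = ⟪x, y⟫_ℂ := fun _ _ => rfl
  have ho : Orthonormal ℂ ((↑) : ({u} : Set V) → V) := by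
    rw [orthonormal_subtype_iff_ite]
    rintro v rfl w rfl
    rw [← hin, hu]
    simp
  obtain ⟨w, b, hw, hb⟩ := ho.exists_orthonormalBasis_extension
  have hmem : u ∈ w := by simpa using hw
  let e := Fintype.equivFin w
  refine ⟨_, fun i => b (e.symm i), fun i j => ?_, fun v => ?_, e ⟨u, hmem⟩, ?_⟩
  · rw [hin, orthonormal_iff_ite.1 b.orthonormal]
    simp
  · simp only [hin]
    rw [e.symm.sum_comp (fun i => ⟪b i, v⟫_ℂ • b i)]
    exact (b.sum_repr' v).symm
  · simp [hb]

/-! ### Factorization of the projection onto a finite-dimensional subalgebra -/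

section FiniteDimensional

variable {N : Type*} [CStarAlgebra N] [PartialOrder N] [StarOrderedRing N] {σ : N →ₗ[ℂ] ℂ}

/-- A finite-dimensional ⋆-subalgebra has a basis that is orthonormal for `σ(x⋆ y)` and contains
the unit. -/
theorem IsFaithfulTracialState.exists_basis (hσ : IsFaithfulTracialState σ) (B : StarSubalgebra ℂ N)
    [FiniteDimensional ℂ B] :
    ∃ (n : ℕ) (e : Fin n → N), (∀ i, e i ∈ B) ∧
      (∀ i j, σ (star (e i) * e j) = if i = j then 1 else 0) ∧
      (∀ b ∈ B, b = ∑ i, σ (star (e i) * b) • e i) ∧ ∃ i, e i = 1 := by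
  let ip : InnerProductSpace.Core ℂ B :=
    { inner := fun x y => σ (star (x : N) * y)
      conj_inner_symm := fun x y => by
        change star (σ (star (y : N) * x)) = _
        rw [← hσ.map_star, star_mul, star_star]
      re_inner_nonneg := fun x => hσ.re_nonneg _
      add_left := fun x y z => by simp [add_mul]
      smul_left := fun x y r => by simp
      definite := fun x hx => Subtype.ext (hσ.faithful _ hx) }
  obtain ⟨n, e, h1, h2, i, h3⟩ := exists_orthonormalBasis_of_core ip 1 (by
    change σ (star ((1 : B) : N) * ((1 : B) : N)) = 1
    simp [hσ.map_one])
  refine ⟨n, fun i => e i, fun i => (e i).2, h1, fun b hb => ?_, i, congrArg Subtype.val h3⟩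
  exact (congrArg B.subtype (h2 ⟨b, hb⟩)).trans (map_sum B.subtype _ _)

/-- The element `z^{-1/2}`, for `z ≥ 1`. -/
theorem exists_selfAdjoint_mul_mul_eq_one {z : N} (hz : 1 ≤ z) :
    ∃ r : N, star r = r ∧ r * z * r = 1 ∧ ∀ c, Commute z c → Commute r c := by
  have hz0 : 0 ≤ z := zero_le_one.trans hz
  have hsp : ∀ t ∈ spectrum ℝ z, 1 ≤ t := by
    have : algebraMap ℝ N 1 ≤ z := by simpa using hz
    exact (algebraMap_le_iff_le_spectrum (.of_nonneg hz0)).1 this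
  have hc : ContinuousOn (fun t : ℝ => (√t)⁻¹) (spectrum ℝ z) := by
    refine ContinuousOn.inv₀ (by fun_prop) fun t ht => ?_
    have := hsp t ht
    positivity
  refine ⟨cfc (fun t : ℝ => (√t)⁻¹) z, (cfc_predicate _ z : IsSelfAdjoint _).star_eq, ?_,
    fun c h => ?_⟩
  · nth_rewrite 2 [← cfc_id' ℝ z]
    rw [← cfc_mul .., ← cfc_mul .., ← cfc_one ℝ z]
    refine cfc_congr fun t ht => ?_
    have h1 := hsp t ht
    have : 0 < √t := Real.sqrt_pos.2 (by linarith)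
    have h2 := Real.mul_self_sqrt (show 0 ≤ t by linarith)
    simp only [Pi.one_apply]
    field_simp
    nlinarith
  · exact (IsSelfAdjoint.of_nonneg hz0).commute_cfc h _

/-- The orthogonal projection `E` onto a finite-dimensional ⋆-subalgebra `B` factors as a unital
completely positive map `φ` into a matrix algebra followed by a unital completely positive map `ψ`.
For an orthonormal basis `e` of `B` the entries of `φ x` are `σ((e i)⋆ x (e j))`, the matrix of the
compression of left multiplication by `x` to `B ⊆ L²`. The element `z = ∑ e j (e j)⋆` is central in
`B`, so `r = z^{-1/2}` commutes with `B`, and `ψ m = ∑ m i j • r e i (e j)⋆ r` satisfies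
`ψ (φ x) = r E(x) z r = E(x)`. The map `φ` is presented by its functional `s` on matrices, since it
is `s` that gets extended to matrices over `B(H)`. -/
theorem IsFaithfulTracialState.exists_factorization (hσ : IsFaithfulTracialState σ)
    (B : StarSubalgebra ℂ N) [FiniteDimensional ℂ B] :
    ∃ (n : ℕ) (s : CStarMatrix (Fin n) (Fin n) N →ₗ[ℂ] ℂ) (hs : ∀ X, 0 ≤ X → 0 ≤ s X)
      (ψ : CStarMatrix (Fin n) (Fin n) ℂ →CP N) (E : N →ₗ[ℂ] N),
      CStarMatrix.ofFunctional s hs 1 = 1 ∧ ψ 1 = 1 ∧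
      (∀ x, ψ (CStarMatrix.ofFunctional s hs x) = E x) ∧ (∀ x, E x ∈ B) ∧
      ∀ x, ∀ b ∈ B, l2norm σ (x - E x) ≤ l2norm σ (x - b) := by
  obtain ⟨n, e, heB, hon, hbasis, o, ho⟩ := hσ.exists_basis B
  let E : N →ₗ[ℂ] N :=
    { toFun := fun x => ∑ i, σ (star (e i) * x) • e i
      map_add' := fun x y => by simp [mul_add, add_smul, Finset.sum_add_distrib]
      map_smul' := fun c x => by simp [Finset.smul_sum, smul_smul] }
  have hE : ∀ x, E x = ∑ i, σ (star (e i) * x) • e i := fun _ => rfl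
  have hEB : ∀ x, E x ∈ B := fun x => by
    rw [hE]
    exact sum_mem fun i _ => SMulMemClass.smul_mem _ (heB i)
  have hσE : ∀ c ∈ B, ∀ x, σ (star c * E x) = σ (star c * x) := by
    intro c hc x
    have h1 : ∀ i, σ (star c * e i) = star (σ (star (e i) * c)) := fun i => by
      rw [← hσ.map_star, star_mul, star_star]
    conv_rhs => rw [hbasis c hc]
    simp only [hE, Finset.mul_sum, mul_smul_comm, map_sum, map_smul, h1, star_sum, star_smul,
      Finset.sum_mul, smul_mul_assoc, smul_eq_mul]
    exact Finset.sum_congr rfl fun i _ => mul_comm _ _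
  have hEmul : ∀ c ∈ B, ∀ x, E (x * c) = E x * c := by
    intro c hc x
    rw [hbasis (E x * c) (mul_mem (hEB x) hc), hE]
    refine Finset.sum_congr rfl fun i _ => ?_
    congr 1
    have h1 : ∀ y, σ (star (e i) * (y * c)) = σ (star (e i * star c) * y) := fun y => by
      rw [← mul_assoc, hσ.tracial, star_mul, star_star, mul_assoc]
    rw [h1, h1, hσE _ (mul_mem (heB i) (star_mem hc))]
  let s : CStarMatrix (Fin n) (Fin n) N →ₗ[ℂ] ℂ :=
    { toFun := fun X => ∑ i, ∑ j, σ (star (e i) * X i j * e j)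
      map_add' := fun X Y => by simp [mul_add, add_mul, Finset.sum_add_distrib]
      map_smul' := fun c X => by simp [Finset.mul_sum] }
  have hs : ∀ X, 0 ≤ X → 0 ≤ s X := by
    intro X hX
    have := hσ.nonneg (CStarMatrix.sum_star_mul_mul_nonneg hX e)
    simpa [s] using this
  have hφ : ∀ x i j, CStarMatrix.ofFunctional s hs x i j = σ (star (e i) * x * e j) := by
    intro x i j
    rw [CStarMatrix.ofFunctional_apply]
    simp only [s, LinearMap.coe_mk, AddHom.coe_mk, CStarMatrix.entry_apply]
    rw [Finset.sum_eq_single i (fun a _ ha => by simp [ha]) (by simp),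
      Finset.sum_eq_single j (fun a _ ha => by simp [ha]) (by simp)]
    simp
  -- Column `j` of `φ x` expands `E (x * e j) = E x * e j` in the basis.
  have hφE : ∀ x j, ∑ i, CStarMatrix.ofFunctional s hs x i j • e i = E x * e j := by
    intro x j
    rw [← hEmul _ (heB j), hE]
    simp only [hφ, mul_assoc]
  let z : N := ∑ j, e j * star (e j)
  -- The basis contains the unit, so `z` dominates `1 * star 1`.
  have hz : 1 ≤ z := by
    have : e o * star (e o) ≤ z :=
      Finset.single_le_sum (f := fun j => e j * star (e j))
        (fun j _ => mul_star_self_nonneg (e j)) (Finset.mem_univ o)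
    simpa [ho] using this
  -- `c * z` and `z * c` have the same coefficients on the products `e i * star (e j)`.
  have hzc : ∀ c ∈ B, Commute z c := by
    intro c hc
    have h1 : ∀ j, c * e j = ∑ i, σ (star (e i) * (c * e j)) • e i := fun j =>
      hbasis _ (mul_mem hc (heB j))
    have h2 : ∀ j, star (e j) * c = ∑ i, σ (star (e j) * (c * e i)) • star (e i) := fun j => by
      have := congrArg star (hbasis _ (mul_mem (star_mem hc) (heB j)))
      rw [star_mul, star_star] at this
      rw [this, star_sum]
      refine Finset.sum_congr rfl fun i _ => ?_
      rw [star_smul, ← hσ.map_star]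
      simp [mul_assoc]
    change (∑ j, e j * star (e j)) * c = c * ∑ j, e j * star (e j)
    rw [Finset.sum_mul, Finset.mul_sum]
    have h3 : ∀ j, e j * star (e j) * c
        = ∑ i, σ (star (e j) * (c * e i)) • (e j * star (e i)) := fun j => by
      rw [mul_assoc, h2, Finset.mul_sum]
      simp only [mul_smul_comm]
    have h4 : ∀ j, c * (e j * star (e j))
        = ∑ i, σ (star (e i) * (c * e j)) • (e i * star (e j)) := fun j => by
      rw [← mul_assoc]
      nth_rewrite 1 [h1]
      rw [Finset.sum_mul]
      simp only [smul_mul_assoc]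
    simp only [h3, h4]
    exact Finset.sum_comm
  obtain ⟨r, hr, hrz, hrc⟩ := exists_selfAdjoint_mul_mul_eq_one hz
  have hψ : ∀ m, CStarMatrix.ofVectors (fun i => r * e i) m
      = r * (∑ j, (∑ i, m i j • e i) * star (e j)) * r := by
    intro m
    rw [CStarMatrix.ofVectors_apply, Finset.sum_comm, Finset.mul_sum, Finset.sum_mul]
    refine Finset.sum_congr rfl fun j _ => ?_
    rw [Finset.sum_mul, Finset.mul_sum, Finset.sum_mul]
    refine Finset.sum_congr rfl fun i _ => ?_
    rw [star_mul, hr, smul_mul_assoc, mul_smul_comm, smul_mul_assoc]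
    simp only [mul_assoc]
  refine ⟨n, s, hs, CStarMatrix.ofVectors fun i => r * e i, E, ?_, ?_, fun x => ?_, hEB,
    fun x b hb => ?_⟩
  · ext i j
    rw [hφ, mul_one, hon, CStarMatrix.one_apply]
  · rw [hψ]
    simp only [CStarMatrix.one_apply, ite_smul, one_smul, zero_smul, Finset.sum_ite_eq',
      Finset.mem_univ, if_true]
    exact hrz
  · rw [hψ]
    simp only [hφE, mul_assoc]
    rw [← Finset.mul_sum]
    change r * (E x * z * r) = E x
    have := (hrc _ (hzc _ (hEB x))).eq
    rw [← mul_assoc, ← mul_assoc, this, mul_assoc, mul_assoc, ← mul_assoc r, hrz, mul_one]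
  · refine abs_le_of_sq_le_sq' ?_ (l2norm_nonneg _ _) |>.2
    rw [hσ.l2norm_sq, hσ.l2norm_sq]
    -- Pythagoras: `x - b = (x - E x) + (E x - b)`, an orthogonal sum.
    have hv : E x - b ∈ B := sub_mem (hEB x) hb
    set v := E x - b with hvdef
    set u := x - E x with hu
    have hxb : x - b = u + v := by rw [hu, hvdef]; abel
    have h1 : σ (star v * u) = 0 := by
      rw [hu, mul_sub, map_sub, hσE _ hv, sub_self]
    have h2 : σ (star u * v) = 0 := by
      have := hσ.map_star (star v * u)
      rwa [h1, star_zero, star_mul, star_star] at this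
    rw [hxb, star_add, add_mul, mul_add, mul_add, map_add, map_add, map_add, h1, h2]
    have := hσ.re_nonneg v
    simpa using this

end FiniteDimensional

/-! ### An approximate Radon–Nikodym theorem -/

section RadonNikodym

variable {C : Type*} [CStarAlgebra C] [PartialOrder C] [StarOrderedRing C] {τ : C →ₗ[ℂ] ℂ}

/-- A self-adjoint `y` is its truncation `h` to `[0, 1]`, plus the excess `p = (y - 1)⁺`, minus
`m = y⁻`. -/
theorem exists_clamp {y : C} (hy : IsSelfAdjoint y) :
    ∃ h p m : C, 0 ≤ h ∧ h ≤ 1 ∧ 0 ≤ p ∧ 0 ≤ m ∧ y = h + p - m ∧ y * p = p + p * p ∧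
      y * m = -(m * m) := by
  refine ⟨cfc (fun t : ℝ => max 0 (min t 1)) y, cfc (fun t : ℝ => max (t - 1) 0) y,
    cfc (fun t : ℝ => max (-t) 0) y, cfc_nonneg fun t _ => le_max_left _ _,
    cfc_le_one _ _ fun t _ => max_le zero_le_one (min_le_right _ _),
    cfc_nonneg fun t _ => le_max_right _ _, cfc_nonneg fun t _ => le_max_right _ _, ?_, ?_, ?_⟩
  · rw [← cfc_add .., ← cfc_sub ..]
    conv_lhs => rw [← cfc_id' ℝ y]
    refine cfc_congr fun t _ => ?_
    rcases le_total t 0 with h | h <;> rcases le_total t 1 with h' | h' <;>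
      (simp [h, h']; try linarith)
  · conv_lhs => enter [1]; rw [← cfc_id' ℝ y]
    rw [← cfc_mul .., ← cfc_mul .., ← cfc_add ..]
    refine cfc_congr fun t _ => ?_
    rcases le_total t 1 with h' | h'
    · simp [h']
    · simp only [sub_nonneg, h', max_eq_left]; ring
  · conv_lhs => enter [1]; rw [← cfc_id' ℝ y]
    rw [← cfc_mul .., ← cfc_mul .., ← cfc_neg ..]
    refine cfc_congr fun t _ => ?_
    rcases le_total t 0 with h' | h'
    · simp [h']
    · simp [h']

namespace IsFaithfulTracialState

/-- If `0 ≤ f ≤ τ`, then `f` is approximately of the form `τ(y ·)` with `y` self-adjoint, the error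
being small in the 2-norm. The element `y` almost minimizes `τ(y²) - 2 f(y)` over the self-adjoint
elements, so no completion to a Hilbert space is needed. -/
theorem exists_approx_density (hτ : IsFaithfulTracialState τ) (f : C →ₗ[ℂ] ℂ)
    (hf : ∀ x, 0 ≤ x → 0 ≤ f x) (hfτ : ∀ x, 0 ≤ x → f x ≤ τ x) {δ : ℝ} (hδ : 0 < δ) :
    ∃ y : C, IsSelfAdjoint y ∧ ∀ a, IsSelfAdjoint a →
      |(τ (y * a)).re - (f a).re| ≤ δ * l2norm τ a := by
  -- Cauchy–Schwarz for `f`, which is dominated by `τ`.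
  have hfb : ∀ a, |(f a).re| ≤ l2norm τ a := by
    intro a
    let F : C →ₚ[ℂ] ℂ := .mk₀ f hf
    have h1 : ‖f (star 1 * a)‖ ≤ √(f (star 1 * 1)).re * √(f (star a * a)).re :=
      norm_inner_le_norm (𝕜 := ℂ) (F.toPreGNS 1) (F.toPreGNS a)
    have h2 : √(f (star 1 * 1)).re ≤ 1 := by
      rw [Real.sqrt_le_one]
      have := (Complex.le_def.1 (hfτ 1 zero_le_one)).1
      simpa [hτ.map_one] using this
    have h3 : √(f (star a * a)).re ≤ l2norm τ a :=
      Real.sqrt_le_sqrt (Complex.le_def.1 (hfτ _ (_root_.star_mul_self_nonneg a))).1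
    rw [star_one, one_mul] at h1
    rw [star_one] at h2
    refine (Complex.abs_re_le_norm _).trans (h1.trans ?_)
    exact (mul_le_mul h2 h3 (Real.sqrt_nonneg _) zero_le_one).trans_eq (one_mul _)
  let q : C → ℝ := fun y => l2norm τ y ^ 2 - 2 * (f y).re
  let S : Set ℝ := q '' {y | IsSelfAdjoint y}
  have hbdd : BddBelow S := by
    refine ⟨-1, ?_⟩
    rintro _ ⟨y, -, rfl⟩
    have := (abs_le.1 (hfb y)).2
    simp only [q]
    nlinarith [sq_nonneg (l2norm τ y - 1)]
  obtain ⟨_, ⟨y, hy, rfl⟩, hlt⟩ := Real.lt_sInf_add_pos (s := S) ⟨_, 0, .zero C, rfl⟩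
    (show 0 < δ ^ 2 by positivity)
  -- A `δ²`-minimizer suffices: the quadratic polynomial `t ↦ q (y + t a) - q y + δ²` is
  -- nonnegative, and its discriminant bounds the linear coefficient.
  refine ⟨y, hy, fun a ha => ?_⟩
  have hexp : ∀ t : ℝ, q (y + (t : ℂ) • a)
      = q y + 2 * t * ((τ (y * a)).re - (f a).re) + t ^ 2 * l2norm τ a ^ 2 := by
    intro t
    have h1 : star (y + (t : ℂ) • a) * (y + (t : ℂ) • a) = star y * y + (t : ℂ) • (y * a)
        + (t : ℂ) • (a * y) + ((t ^ 2 : ℝ) : ℂ) • (star a * a) := by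
      rw [star_add, star_smul, hy.star_eq, ha.star_eq]
      simp only [Complex.star_def, Complex.conj_ofReal, mul_add, add_mul, smul_mul_assoc,
        mul_smul_comm, smul_add, smul_smul, pow_two, Complex.ofReal_mul]
      abel
    simp only [q, hτ.l2norm_sq]
    rw [h1]
    simp only [map_add, map_smul, smul_eq_mul, Complex.add_re, Complex.re_ofReal_mul,
      hτ.tracial a y]
    ring
  have hquad : ∀ t : ℝ, 0 ≤ (l2norm τ a ^ 2) * (t * t)
      + (2 * ((τ (y * a)).re - (f a).re)) * t + δ ^ 2 := by
    intro t
    have h1 : sInf S ≤ q (y + (t : ℂ) • a) :=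
      csInf_le hbdd ⟨_, hy.add (IsSelfAdjoint.smul (by simp [isSelfAdjoint_iff]) ha), rfl⟩
    rw [hexp] at h1
    nlinarith
  have hd := discrim_le_zero hquad
  rw [discrim] at hd
  refine abs_le_of_sq_le_sq ?_ (mul_nonneg hδ.le (l2norm_nonneg _ _))
  nlinarith

/-- The approximate density can be taken in `[0, 1]`: truncate `y`. Testing the approximation on
the excess parts `p` and `m` themselves shows that they are of 2-norm at most `δ`. -/
theorem exists_approx_density_unitInterval (hτ : IsFaithfulTracialState τ) (f : C →ₗ[ℂ] ℂ)
    (hf : ∀ x, 0 ≤ x → 0 ≤ f x) (hfτ : ∀ x, 0 ≤ x → f x ≤ τ x) {δ : ℝ} (hδ : 0 < δ) :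
    ∃ h : C, 0 ≤ h ∧ h ≤ 1 ∧ ∀ a, IsSelfAdjoint a →
      |(τ (h * a)).re - (f a).re| ≤ 3 * δ * l2norm τ a := by
  obtain ⟨y, hy, hyf⟩ := hτ.exists_approx_density f hf hfτ hδ
  obtain ⟨h, p, m, h0, h1, hp, hm, hsum, hyp, hym⟩ := exists_clamp hy
  have hps : IsSelfAdjoint p := .of_nonneg hp
  have hms : IsSelfAdjoint m := .of_nonneg hm
  have aux : ∀ r : ℝ, 0 ≤ r → r ^ 2 ≤ δ * r → r ≤ δ := by
    intro r hr h
    rcases hr.eq_or_lt with rfl | hr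
    · exact hδ.le
    · nlinarith
  have hpδ : l2norm τ p ≤ δ := by
    refine aux _ (l2norm_nonneg _ _) ?_
    have e1 := (abs_le.1 (hyf p hps)).2
    have e2 := (Complex.le_def.1 (hfτ p hp)).1
    rw [hτ.l2norm_sq, hps.star_eq]
    rw [hyp, map_add, Complex.add_re] at e1
    linarith
  have hmδ : l2norm τ m ≤ δ := by
    refine aux _ (l2norm_nonneg _ _) ?_
    have e1 := (abs_le.1 (hyf m hms)).1
    have e2 := (Complex.le_def.1 (hf m hm)).1
    rw [hτ.l2norm_sq, hms.star_eq]
    rw [hym, map_neg, Complex.neg_re] at e1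
    rw [Complex.zero_re] at e2
    linarith
  refine ⟨h, h0, h1, fun a ha => ?_⟩
  have hcs : ∀ z, IsSelfAdjoint z → |(τ (z * a)).re| ≤ l2norm τ z * l2norm τ a := fun z hz => by
    have := hτ.norm_map_star_mul_le z a
    rw [hz.star_eq] at this
    exact (Complex.abs_re_le_norm _).trans this
  have e : (τ (h * a)).re = (τ (y * a)).re - (τ (p * a)).re + (τ (m * a)).re := by
    rw [hsum, sub_mul, add_mul, map_sub, map_add, Complex.sub_re, Complex.add_re]
    ring
  have ha0 := l2norm_nonneg τ a
  have b1 := abs_le.1 (hyf a ha)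
  have b2 := abs_le.1 ((hcs p hps).trans (mul_le_mul_of_nonneg_right hpδ ha0))
  have b3 := abs_le.1 ((hcs m hms).trans (mul_le_mul_of_nonneg_right hmδ ha0))
  rw [e, abs_le]
  constructor <;> linarith [b1.1, b1.2, b2.1, b2.2, b3.1, b3.2]

end IsFaithfulTracialState

end RadonNikodym

/-! ### `σ`-weak compactness of balls, and the Radon–Nikodym theorem -/

theorem summable_norm_mul_norm {H : Type*} [NormedAddCommGroup H] {ξ η : ℕ → H}
    (hξ : Summable fun n => ‖ξ n‖ ^ 2) (hη : Summable fun n => ‖η n‖ ^ 2) :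
    Summable fun n => ‖ξ n‖ * ‖η n‖ :=
  Summable.of_nonneg_of_le (fun n => by positivity)
    (fun n => by nlinarith [sq_nonneg (‖ξ n‖ - ‖η n‖), sq_nonneg (‖ξ n‖), sq_nonneg (‖η n‖)])
    (hξ.add hη)

namespace VonNeumannAlgebra

section Compactness

variable {H : Type*} [NormedAddCommGroup H] [InnerProductSpace ℂ H] [CompleteSpace H]

/-- A bounded family of operators converges in the weak operator topology along any ultrafilter. -/
theorem exists_ultrafilter_inner_limit {ι : Type*} (U : Ultrafilter ι) (x : ι → H →L[ℂ] H)
    {R : ℝ} (hR : 0 ≤ R) (hx : ∀ i, ‖x i‖ ≤ R) :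
    ∃ y : H →L[ℂ] H, ‖y‖ ≤ R ∧
      ∀ ξ η, Tendsto (fun i => ⟪ξ, x i η⟫_ℂ) U (𝓝 ⟪ξ, y η⟫_ℂ) := by
  have hb : ∀ i ξ η, ‖⟪ξ, x i η⟫_ℂ‖ ≤ R * ‖ξ‖ * ‖η‖ := fun i ξ η => by
    calc ‖⟪ξ, x i η⟫_ℂ‖ ≤ ‖ξ‖ * ‖x i η‖ := norm_inner_le_norm _ _
      _ ≤ ‖ξ‖ * (R * ‖η‖) := by gcongr; exact (x i).le_of_opNorm_le (hx i) η
      _ = _ := by ring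
  have hlim : ∀ ξ η, ∃ l, Tendsto (fun i => ⟪ξ, x i η⟫_ℂ) U (𝓝 l) := fun ξ η => by
    have hc := isCompact_closedBall (0 : ℂ) (R * ‖ξ‖ * ‖η‖)
    obtain ⟨l, -, hl⟩ := hc.ultrafilter_le_nhds (U.map fun i => ⟪ξ, x i η⟫_ℂ) (by
      rw [le_principal_iff]
      exact Filter.mem_map.2 (univ_mem' fun i => by simpa using hb i ξ η))
    exact ⟨l, hl⟩
  choose l hl using hlim
  have hlb : ∀ ξ η, ‖l ξ η‖ ≤ R * ‖ξ‖ * ‖η‖ := fun ξ η =>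
    le_of_tendsto (hl ξ η).norm (Eventually.of_forall fun i => hb i ξ η)
  let B : H →L⋆[ℂ] H →L[ℂ] ℂ := LinearMap.mkContinuous₂
    (LinearMap.mk₂'ₛₗ (starRingEnd ℂ) (RingHom.id ℂ) l
      (fun a b c => tendsto_nhds_unique (hl _ _)
        (((hl a c).add (hl b c)).congr fun i => (inner_add_left _ _ _).symm))
      (fun r a c => tendsto_nhds_unique (hl _ _)
        (((hl a c).const_mul _).congr fun i => (inner_smul_left _ _ _).symm))
      (fun a b c => tendsto_nhds_unique (hl _ _)
        (((hl a b).add (hl a c)).congr fun i => by rw [map_add, inner_add_right]))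
      (fun r a c => tendsto_nhds_unique (hl _ _)
        (((hl a c).const_mul _).congr fun i => by
          rw [map_smul, inner_smul_right]; rfl))) R hlb
  let y : H →L[ℂ] H := ContinuousLinearMap.adjoint (InnerProductSpace.continuousLinearMapOfBilin B)
  have hy : ∀ ξ η, ⟪ξ, y η⟫_ℂ = l ξ η := fun ξ η => by
    rw [ContinuousLinearMap.adjoint_inner_right,
      InnerProductSpace.continuousLinearMapOfBilin_apply]
    rfl
  refine ⟨y, ContinuousLinearMap.opNorm_le_bound _ hR fun η => ?_, fun ξ η => ?_⟩
  · have h := hlb (y η) η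
    rw [← hy, inner_self_eq_norm_sq_to_K] at h
    simp only [norm_pow, Complex.coe_algebraMap, Complex.norm_real, norm_norm] at h
    rcases (norm_nonneg (y η)).eq_or_lt with h0 | h0
    · rw [← h0]; positivity
    · nlinarith
  · rw [hy]; exact hl ξ η

/-- A von Neumann algebra is closed in the weak operator topology, being a commutant. -/
theorem mem_of_tendsto_inner (M : VonNeumannAlgebra H) {ι : Type*} {l : Filter ι} [l.NeBot]
    {x : ι → H →L[ℂ] H} (hx : ∀ i, x i ∈ M) {y : H →L[ℂ] H}
    (hy : ∀ ξ η, Tendsto (fun i => ⟪ξ, x i η⟫_ℂ) l (𝓝 ⟪ξ, y η⟫_ℂ)) : y ∈ M := by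
  rw [← SetLike.mem_coe, ← M.centralizer_centralizer, Set.mem_centralizer_iff]
  intro z hz
  ext η
  refine ext_inner_left ℂ fun ξ => ?_
  have h1 := hy (ContinuousLinearMap.adjoint z ξ) η
  simp only [ContinuousLinearMap.adjoint_inner_left] at h1
  refine tendsto_nhds_unique h1 ((hy ξ (z η)).congr fun i => ?_)
  have := congrArg (fun T : H →L[ℂ] H => T η) (Set.mem_centralizer_iff.1 hz (x i) (hx i))
  simp only [mul_apply_eq_comp] at this
  rw [this]

/-- Balls of a von Neumann algebra are `σ`-weakly compact, in the form of convergence along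
ultrafilters. -/
theorem exists_ultrafilter_limit (M : VonNeumannAlgebra H) {ι : Type*} (U : Ultrafilter ι)
    (x : ι → M) {R : ℝ} (hR : 0 ≤ R) (hx : ∀ i, ‖x i‖ ≤ R) :
    ∃ y : M, ‖y‖ ≤ R ∧ M.TendstoSigmaWeak x U y := by
  obtain ⟨y, hyR, hy⟩ := exists_ultrafilter_inner_limit U (fun i => (x i : H →L[ℂ] H)) hR hx
  refine ⟨⟨y, M.mem_of_tendsto_inner (fun i => (x i).2) hy⟩, hyR, ?_⟩
  rintro f ⟨ξ, η, hξ, hη, hf⟩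
  rw [← (hf ⟨y, _⟩).tsum_eq]
  simp only [← fun i => (hf (x i)).tsum_eq]
  refine tendsto_tsum_of_dominated_convergence
    ((summable_norm_mul_norm hξ hη).mul_left R) (fun n => hy (ξ n) (η n))
    (Eventually.of_forall fun i n => ?_)
  calc ‖⟪ξ n, (x i : H →L[ℂ] H) (η n)⟫_ℂ‖ ≤ ‖ξ n‖ * ‖(x i : H →L[ℂ] H) (η n)‖ :=
        norm_inner_le_norm _ _
    _ ≤ ‖ξ n‖ * (R * ‖η n‖) := by
        gcongr
        exact (x i : H →L[ℂ] H).le_of_opNorm_le (hx i) _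
    _ = _ := by ring

theorem IsNormalFunctional.mul_left {M : VonNeumannAlgebra H} {f : M →ₗ[ℂ] ℂ}
    (hf : M.IsNormalFunctional f) (a : M) :
    M.IsNormalFunctional (f ∘ₗ LinearMap.mulLeft ℂ a) := by
  obtain ⟨ξ, η, hξ, hη, hf⟩ := hf
  refine ⟨fun n => ContinuousLinearMap.adjoint (a : H →L[ℂ] H) (ξ n), η, ?_, hη, fun x => ?_⟩
  · refine Summable.of_nonneg_of_le (fun n => by positivity) (fun n => ?_)
      (hξ.mul_left (‖ContinuousLinearMap.adjoint (a : H →L[ℂ] H)‖ ^ 2))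
    rw [← mul_pow]
    gcongr
    exact ContinuousLinearMap.le_opNorm _ _
  · simp only [ContinuousLinearMap.adjoint_inner_left]
    exact hf (a * x)

theorem IsNormalFunctional.mul_right {M : VonNeumannAlgebra H} {f : M →ₗ[ℂ] ℂ}
    (hf : M.IsNormalFunctional f) (a : M) :
    M.IsNormalFunctional (f ∘ₗ LinearMap.mulRight ℂ a) := by
  obtain ⟨ξ, η, hξ, hη, hf⟩ := hf
  refine ⟨ξ, fun n => (a : H →L[ℂ] H) (η n), hξ, ?_, fun x => hf (x * a)⟩
  refine Summable.of_nonneg_of_le (fun n => by positivity) (fun n => ?_)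
    (hη.mul_left (‖(a : H →L[ℂ] H)‖ ^ 2))
  rw [← mul_pow]
  gcongr
  exact ContinuousLinearMap.le_opNorm _ _

/-- Vector functionals are normal. -/
theorem exists_isNormalFunctional_inner (M : VonNeumannAlgebra H) (ξ η : H) :
    ∃ f : M →ₗ[ℂ] ℂ, M.IsNormalFunctional f ∧ ∀ x : M, f x = ⟪ξ, (x : H →L[ℂ] H) η⟫_ℂ := by
  let f : M →ₗ[ℂ] ℂ :=
    { toFun := fun x => ⟪ξ, (x : H →L[ℂ] H) η⟫_ℂ
      map_add' := fun x y => by simp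
      map_smul' := fun c x => by simp }
  refine ⟨f, ⟨Pi.single 0 ξ, Pi.single 0 η, ?_, ?_, fun x => ?_⟩, fun _ => rfl⟩
  · exact summable_of_ne_finset_zero (s := {0}) fun n hn => by
      simp [Pi.single_eq_of_ne (Finset.notMem_singleton.1 hn)]
  · exact summable_of_ne_finset_zero (s := {0}) fun n hn => by
      simp [Pi.single_eq_of_ne (Finset.notMem_singleton.1 hn)]
  · have := hasSum_single (f := fun n => ⟪(Pi.single 0 ξ : ℕ → H) n,
      (x : H →L[ℂ] H) ((Pi.single 0 η : ℕ → H) n)⟫_ℂ) 0 (fun n hn => by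
        simp [Pi.single_eq_of_ne hn])
    simpa [f] using this

theorem IsTrace.isFaithfulTracialState {M : VonNeumannAlgebra H} {τ : M →ₗ[ℂ] ℂ}
    (hτ : M.IsTrace τ) : IsFaithfulTracialState τ :=
  ⟨hτ.map_one, hτ.nonneg, hτ.tracial, hτ.faithful⟩

/-- On bounded sets, convergence in 2-norm implies `σ`-weak convergence: a `σ`-weak limit `y` along
an ultrafilter satisfies `τ(y⋆ y) = lim τ(y⋆ x i) = 0`. -/
theorem IsTrace.tendsto_of_l2norm {M : VonNeumannAlgebra H} {τ : M →ₗ[ℂ] ℂ} (hτ : M.IsTrace τ)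
    {ι : Type*} {l : Filter ι} {x : ι → M} {R : ℝ} (hx : ∀ i, ‖x i‖ ≤ R)
    (h : Tendsto (fun i => l2norm τ (x i)) l (𝓝 0)) {f : M →ₗ[ℂ] ℂ}
    (hf : M.IsNormalFunctional f) : Tendsto (fun i => f (x i)) l (𝓝 0) := by
  rw [tendsto_iff_ultrafilter]
  intro U hU
  have hne : Nonempty ι := U.neBot.nonempty
  have hR : 0 ≤ R := (norm_nonneg _).trans (hx hne.some)
  obtain ⟨y, -, hy⟩ := M.exists_ultrafilter_limit U x hR hx
  have hy0 : y = 0 := by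
    refine hτ.faithful y ?_
    have h1 := hy _ (hτ.normal.mul_left (star y))
    refine tendsto_nhds_unique h1 (squeeze_zero_norm (a := fun i => l2norm τ y * l2norm τ (x i))
      (fun i => hτ.isFaithfulTracialState.norm_map_star_mul_le y (x i)) ?_)
    simpa using (h.mono_left hU).const_mul (l2norm τ y)
  have := hy f hf
  rwa [hy0, map_zero] at this

/-- The Radon–Nikodym theorem for the trace: a functional `0 ≤ f ≤ τ` is `τ(h ·)` for some `h` in
the algebra, a `σ`-weak limit of approximate densities in the unit ball. Normality of `f` is not
assumed; it follows. -/
theorem IsTrace.exists_density {M : VonNeumannAlgebra H} {τ : M →ₗ[ℂ] ℂ} (hτ : M.IsTrace τ)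
    (f : M →ₗ[ℂ] ℂ) (hf : ∀ x, 0 ≤ x → 0 ≤ f x) (hfτ : ∀ x, 0 ≤ x → f x ≤ τ x) :
    ∃ h : M, ∀ a, τ (h * a) = f a := by
  have hτ' := hτ.isFaithfulTracialState
  choose h h0 h1 hh using fun k : ℕ =>
    hτ'.exists_approx_density_unitInterval f hf hfτ (δ := 1 / ((k : ℝ) + 1)) (by positivity)
  have hn : ∀ k, ‖h k‖ ≤ 1 := fun k =>
    (CStarAlgebra.norm_le_one_iff_of_nonneg (h k) (h0 k)).2 (h1 k)
  obtain ⟨y, -, hy⟩ := M.exists_ultrafilter_limit (hyperfilter ℕ) h zero_le_one hn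
  have hU : ((hyperfilter ℕ : Ultrafilter ℕ) : Filter ℕ) ≤ atTop := by
    rw [← Nat.cofinite_eq_atTop]; exact hyperfilter_le_cofinite
  have hlim : ∀ a, Tendsto (fun k => τ (h k * a)) (hyperfilter ℕ : Ultrafilter ℕ)
      (𝓝 (τ (y * a))) := fun a => hy _ (hτ.normal.mul_right a)
  have hpos : ∀ a, 0 ≤ a → τ (y * a) = f a := by
    intro a ha
    obtain ⟨b, rfl⟩ := exists_eq_star_mul_self_of_nonneg ha
    have hconj : ∀ k, 0 ≤ τ (h k * (star b * b)) := fun k => by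
      rw [← mul_assoc, hτ.tracial, ← mul_assoc]
      exact hτ'.nonneg (star_right_conjugate_nonneg (h0 k) b)
    -- The approximate densities control real parts only; the imaginary parts vanish by positivity.
    have him : (τ (y * (star b * b))).im = 0 := by
      refine tendsto_nhds_unique ((Complex.continuous_im.tendsto _).comp (hlim (star b * b)))
        (tendsto_const_nhds.congr fun k => ?_)
      exact (Complex.le_def.1 (hconj k)).2
    have hre : (τ (y * (star b * b))).re = (f (star b * b)).re := by
      refine tendsto_nhds_unique ((Complex.continuous_re.tendsto _).comp (hlim (star b * b))) ?_
      refine (tendsto_iff_norm_sub_tendsto_zero.2 ?_)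
      refine squeeze_zero (fun _ => norm_nonneg _)
        (fun k => hh k _ (.star_mul_self b)) (Tendsto.mono_left ?_ hU)
      have := (tendsto_one_div_add_atTop_nhds_zero_nat (𝕜 := ℝ)).const_mul 3
      simpa using this.mul_const (l2norm τ (star b * b))
    refine Complex.ext hre ?_
    rw [him, ← (Complex.le_def.1 (hf _ ha)).2]
    rfl
  refine ⟨y, fun a => ?_⟩
  -- Both sides are linear in `a`, and positive elements span.
  have : a ∈ Submodule.span ℂ {a : M | 0 ≤ a} := by
    rw [CStarAlgebra.span_nonneg]; trivial
  exact LinearMap.eqOn_span (f := τ ∘ₗ LinearMap.mulLeft ℂ y) (g := f) hpos this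

end Compactness

end VonNeumannAlgebra

/-! ### Amplifications and density of the generated ⋆-algebra -/

section Amplification

variable {H : Type*} [NormedAddCommGroup H] [InnerProductSpace ℂ H] {ι : Type*}

theorem memℓp_map (T : H →L[ℂ] H) (f : lp (fun _ : ι => H) 2) :
    Memℓp (fun i => T (f i)) 2 :=
  (lp.memℓp ((‖T‖ : ℂ) • f)).mono' fun i => by
    rw [lp.coeFn_smul, Pi.smul_apply, norm_smul, Complex.norm_real, norm_norm]
    exact T.le_opNorm (f i)

/-- The amplification `T ⊗ 1` of `T` to `H ⊗ ℓ²(ι)`, acting on square-summable families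
coordinatewise. -/
noncomputable def amplification (T : H →L[ℂ] H) :
    lp (fun _ : ι => H) 2 →L[ℂ] lp (fun _ : ι => H) 2 :=
  LinearMap.mkContinuous
    { toFun := fun f => ⟨fun i => T (f i), memℓp_map T f⟩
      map_add' := fun f g => lp.ext (funext fun i => by
        change T ((f + g : lp (fun _ : ι => H) 2) i) = T (f i) + T (g i)
        simp)
      map_smul' := fun c f => lp.ext (funext fun i => by
        change T ((c • f : lp (fun _ : ι => H) 2) i) = c • T (f i)
        simp) } ‖T‖ fun f => by
      have h : ‖(‖T‖ : ℂ) • f‖ = ‖T‖ * ‖f‖ := by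
        rw [norm_smul, Complex.norm_real, norm_norm]
      rw [← h]
      refine lp.norm_mono two_ne_zero fun i => ?_
      rw [lp.coeFn_smul, Pi.smul_apply, norm_smul, Complex.norm_real, norm_norm]
      exact T.le_opNorm (f i)

@[simp]
theorem amplification_apply (T : H →L[ℂ] H) (f : lp (fun _ : ι => H) 2) (i : ι) :
    amplification T f i = T (f i) := rfl

theorem amplification_single [DecidableEq ι] (T : H →L[ℂ] H) (i : ι) (η : H) :
    amplification T (lp.single 2 i η) = lp.single 2 i (T η) := by
  refine lp.ext (funext fun j => ?_)
  rw [amplification_apply]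
  rcases eq_or_ne j i with rfl | h
  · simp
  · simp [h]

theorem inner_amplification_left [CompleteSpace H] (T : H →L[ℂ] H) (f g : lp (fun _ : ι => H) 2) :
    ⟪amplification T f, g⟫_ℂ = ⟪f, amplification (star T) g⟫_ℂ := by
  rw [lp.inner_eq_tsum, lp.inner_eq_tsum]
  refine tsum_congr fun i => ?_
  rw [amplification_apply, amplification_apply, ContinuousLinearMap.star_eq_adjoint,
    ContinuousLinearMap.adjoint_inner_right]

variable [CompleteSpace H]

/-- The density step of the bicommutant theorem for amplifications: if `x` is in the bicommutant of
`S`, then `(x ⊗ 1) ζ` is a limit of vectors `(a ⊗ 1) ζ` with `a ∈ S`. The projection onto the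
closure of `(S ⊗ 1) ζ` commutes with `S ⊗ 1`, so its matrix entries `p i j` lie in the commutant of `S`
and commute with `x`; hence the projection commutes with `x ⊗ 1`. -/
theorem exists_mem_norm_amplification_sub_lt (S : StarSubalgebra ℂ (H →L[ℂ] H)) {x : H →L[ℂ] H}
    (hx : x ∈ Set.centralizer (Set.centralizer (S : Set (H →L[ℂ] H))))
    (ζ : lp (fun _ : ι => H) 2) {ε : ℝ} (hε : 0 < ε) :
    ∃ a ∈ S, ‖amplification x ζ - amplification a ζ‖ < ε := by
  classical
  let L : (H →L[ℂ] H) →ₗ[ℂ] lp (fun _ : ι => H) 2 :=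
    { toFun := fun T => amplification T ζ
      map_add' := fun _ _ => rfl
      map_smul' := fun _ _ => rfl }
  let V₀ : Submodule ℂ (lp (fun _ : ι => H) 2) := S.toSubalgebra.toSubmodule.map L
  let V := V₀.topologicalClosure
  have : CompleteSpace V := V₀.isClosed_topologicalClosure.completeSpace_coe
  have hV : ∀ a ∈ S, ∀ v ∈ V, amplification a v ∈ V := by
    intro a ha v hv
    refine map_mem_closure (amplification a).continuous hv ?_
    rintro _ ⟨b, hb, rfl⟩
    exact ⟨a * b, S.mul_mem ha hb, rfl⟩
  have hPcomm : ∀ a ∈ S, ∀ v, V.starProjection (amplification a v)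
      = amplification a (V.starProjection v) := by
    intro a ha v
    refine Submodule.eq_starProjection_of_mem_of_inner_eq_zero
      (hV a ha _ (V.starProjection_apply_mem v)) fun w hw => ?_
    rw [← map_sub, inner_amplification_left]
    rw [← inner_conj_symm, V.sub_starProjection_mem_orthogonal v _ (hV _ (star_mem ha) w hw),
      map_zero]
  let p : ι → ι → H →L[ℂ] H := fun i j =>
    lp.evalCLM ℂ (fun _ : ι => H) 2 i ∘L V.starProjection ∘L
      lp.singleContinuousLinearMap ℂ (fun _ : ι => H) 2 j
  have hp : ∀ i j η, p i j η = V.starProjection (lp.single 2 j η) i := fun _ _ _ => rfl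
  have hpS : ∀ i j, p i j ∈ Set.centralizer (S : Set (H →L[ℂ] H)) := by
    intro i j a ha
    ext η
    simp only [mul_apply_eq_comp, hp]
    rw [← amplification_single, hPcomm a ha, amplification_apply]
  have hsum : ∀ f : lp (fun _ : ι => H) 2, ∀ i,
      HasSum (fun j => p i j (f j)) (V.starProjection f i) := fun f i =>
    (lp.hasSum_single (by norm_num) f).mapL
      (lp.evalCLM ℂ (fun _ : ι => H) 2 i ∘L V.starProjection)
  have hζ : ζ ∈ V := V₀.le_topologicalClosure ⟨1, one_mem S, rfl⟩
  have hfix : V.starProjection (amplification x ζ) = amplification x ζ := by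
    refine lp.ext (funext fun i => (hsum (amplification x ζ) i).unique ?_)
    have h1 := (hsum ζ i).mapL x
    rw [V.starProjection_eq_self_iff.2 hζ] at h1
    rw [amplification_apply]
    refine h1.congr_fun fun j => ?_
    exact congrArg (fun T : H →L[ℂ] H => T (ζ j)) (hx (p i j) (hpS i j))
  have hmem : amplification x ζ ∈ closure (V₀ : Set (lp (fun _ : ι => H) 2)) :=
    V.starProjection_eq_self_iff.1 hfix
  obtain ⟨_, ⟨a, ha, rfl⟩, hlt⟩ := Metric.mem_closure_iff.1 hmem ε hε
  exact ⟨a, ha, by rwa [dist_eq_norm] at hlt⟩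

end Amplification

namespace VonNeumannAlgebra

variable {H : Type*} [NormedAddCommGroup H] [InnerProductSpace ℂ H] [CompleteSpace H]

/-- The von Neumann algebra `S′′` generated by a ⋆-algebra `S` of operators. -/
noncomputable def bicommutant (S : StarSubalgebra ℂ (H →L[ℂ] H)) : VonNeumannAlgebra H where
  toStarSubalgebra :=
    StarSubalgebra.centralizer ℂ (StarSubalgebra.centralizer ℂ (S : Set (H →L[ℂ] H)))
  centralizer_centralizer' := by
    simp

theorem coe_bicommutant (S : StarSubalgebra ℂ (H →L[ℂ] H)) :
    (bicommutant S : Set (H →L[ℂ] H)) =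
      Set.centralizer (Set.centralizer (S : Set (H →L[ℂ] H))) := by
  change ((StarSubalgebra.centralizer ℂ (StarSubalgebra.centralizer ℂ (S : Set (H →L[ℂ] H))) :
    StarSubalgebra ℂ (H →L[ℂ] H)) : Set (H →L[ℂ] H)) = _
  rw [StarSubalgebra.coe_centralizer_centralizer, StarMemClass.star_coe_eq, Set.union_self]

/-- The ⋆-algebra generated by a generating set is dense in 2-norm. A trace `∑ ⟪ξ n, x (η n)⟫` gives
`|y|₂² ≤ ∑ ‖y (ξ n)‖ ‖y (η n)‖`, so it is enough to approximate `x` on all the vectors `ξ n` and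
`η n` at once, that is, on the single vector of `ℓ²(ℕ ⊕ ℕ, H)` that they form. -/
theorem IsTrace.exists_adjoin_l2norm_sub_lt {M : VonNeumannAlgebra H} {τ : M →ₗ[ℂ] ℂ}
    (hτ : M.IsTrace τ) {F : Set M} (hF : M.IsGeneratedBy F) (x : M) {ε : ℝ} (hε : 0 < ε) :
    ∃ a ∈ StarAlgebra.adjoin ℂ F, l2norm τ (x - a) < ε := by
  let j : M →⋆ₐ[ℂ] (H →L[ℂ] H) := M.toStarSubalgebra.subtype
  let S : StarSubalgebra ℂ (H →L[ℂ] H) := (StarAlgebra.adjoin ℂ F).map j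
  have hle : M ≤ bicommutant S := hF.2 fun y hy => by
    rw [← SetLike.mem_coe, coe_bicommutant]
    exact Set.subset_centralizer_centralizer
      ⟨y, StarAlgebra.subset_adjoin ℂ F hy, rfl⟩
  have hx : (x : H →L[ℂ] H) ∈ Set.centralizer (Set.centralizer (S : Set (H →L[ℂ] H))) := by
    rw [← coe_bicommutant]; exact hle x.2
  obtain ⟨ξ, η, hξ, hη, hf⟩ := hτ.normal
  have hmem : Memℓp (Sum.elim ξ η : ℕ ⊕ ℕ → H) 2 := by
    refine memℓp_gen ?_
    exact Summable.sum _ (by simpa [Function.comp_def] using hξ)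
      (by simpa [Function.comp_def] using hη)
  obtain ⟨_, ⟨a, ha, rfl⟩, hlt⟩ := exists_mem_norm_amplification_sub_lt S hx
    (⟨Sum.elim ξ η, hmem⟩ : lp (fun _ : ℕ ⊕ ℕ => H) 2) hε
  refine ⟨a, ha, lt_of_le_of_lt ?_ hlt⟩
  set ζ : lp (fun _ : ℕ ⊕ ℕ => H) 2 := ⟨Sum.elim ξ η, hmem⟩
  set w := amplification (x : H →L[ℂ] H) ζ - amplification (a : H →L[ℂ] H) ζ
  have hw : HasSum (fun i => ‖w i‖ ^ 2) (‖w‖ ^ 2) := by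
    simpa using lp.hasSum_norm (p := 2) (by norm_num) w
  have h1 := (hw.summable.comp_injective (Sum.inl_injective (α := ℕ) (β := ℕ))).hasSum
  have h2 := (hw.summable.comp_injective (Sum.inr_injective (α := ℕ) (β := ℕ))).hasSum
  have h3 := h1.add h2
  rw [(HasSum.sum h1 h2).unique hw] at h3
  have hτ2 := (Complex.hasSum_re (hf (star (x - a) * (x - a))))
  refine abs_le_of_sq_le_sq' ?_ (norm_nonneg _) |>.2
  rw [hτ.isFaithfulTracialState.l2norm_sq]
  refine hasSum_le (fun n => ?_) hτ2 h3
  have hin : ⟪ξ n, ((star (x - a) * (x - a) : M) : H →L[ℂ] H) (η n)⟫_ℂ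
      = ⟪w (Sum.inl n), w (Sum.inr n)⟫_ℂ := by
    change ⟪ξ n, (star ((x : H →L[ℂ] H) - a)) (((x : H →L[ℂ] H) - a) (η n))⟫_ℂ
      = ⟪((x : H →L[ℂ] H) - a) (ξ n), ((x : H →L[ℂ] H) - a) (η n)⟫_ℂ
    rw [ContinuousLinearMap.star_eq_adjoint, ContinuousLinearMap.adjoint_inner_right]
  rw [hin]
  have := (Complex.re_le_norm _).trans (norm_inner_le_norm (𝕜 := ℂ) (w (Sum.inl n)) (w (Sum.inr n)))
  simp only [Function.comp_apply]
  nlinarith [sq_nonneg (‖w (Sum.inl n)‖ - ‖w (Sum.inr n)‖), sq_nonneg (‖w (Sum.inl n)‖),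
    sq_nonneg (‖w (Sum.inr n)‖)]

end VonNeumannAlgebra

/-! ### Conditional expectations and approximate factorizations -/

namespace VonNeumannAlgebra

section Approximation

variable {H : Type*} [NormedAddCommGroup H] [InnerProductSpace ℂ H] [CompleteSpace H]
  {M : VonNeumannAlgebra H} {τ : M →ₗ[ℂ] ℂ}
  {N : Type*} [CStarAlgebra N] [PartialOrder N] [StarOrderedRing N] {σ : N →ₗ[ℂ] ℂ}

theorem IsTrace.eq_of_forall_map_mul_eq (hτ : M.IsTrace τ) {x y : M}
    (h : ∀ a, τ (x * a) = τ (y * a)) : x = y := by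
  rw [← sub_eq_zero]
  refine hτ.faithful _ ?_
  rw [hτ.tracial, sub_mul, map_sub, h, sub_self]

/-- The trace-preserving conditional expectation `E : N → M`, determined by
`τ(E(b) a) = σ(b π(a))`; it exists by the Radon–Nikodym theorem in `M`. The algebra `N` is only
required to be a C⋆-algebra with a faithful trace. -/
theorem IsTrace.exists_conditionalExpectation (hτ : M.IsTrace τ) (hσ : IsFaithfulTracialState σ)
    (π : M →⋆ₐ[ℂ] N) (hπ : ∀ x, σ (π x) = τ x) :
    ∃ E : N →CP M, E 1 = 1 ∧ (∀ x, E (π x) = x) ∧ ∀ b, l2norm τ (E b) ≤ l2norm σ b := by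
  have hex : ∀ b : N, ∃ h : M, ∀ a, τ (h * a) = σ (b * π a) := by
    intro b
    -- It is enough to treat `0 ≤ b ≤ 1`, where `σ(b π(·))` is dominated by `τ`.
    have hb : b ∈ Submodule.span ℂ ({x : N | 0 ≤ x} ∩ Metric.closedBall 0 1) := by
      rw [CStarAlgebra.span_nonneg_inter_unitClosedBall]; trivial
    induction hb using Submodule.span_induction with
    | mem b hb =>
      obtain ⟨hb0, hb1⟩ := hb
      replace hb1 : b ≤ 1 := (CStarAlgebra.norm_le_one_iff_of_nonneg b hb0).1 (by simpa using hb1)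
      have key : ∀ c : N, 0 ≤ c → ∀ x : M, 0 ≤ x → 0 ≤ σ (c * π x) := by
        intro c hc x hx
        obtain ⟨y, rfl⟩ := exists_eq_star_mul_self_of_nonneg hx
        rw [map_mul π, map_star, ← mul_assoc, hσ.tracial, ← mul_assoc]
        exact hσ.nonneg (star_right_conjugate_nonneg hc _)
      refine hτ.exists_density (σ ∘ₗ LinearMap.mulLeft ℂ b ∘ₗ π.toAlgHom.toLinearMap)
        (fun x hx => key b hb0 x hx) fun x hx => ?_
      have := key (1 - b) (sub_nonneg.2 hb1) x hx
      rw [sub_mul, one_mul, map_sub, hπ, sub_nonneg] at this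
      exact this
    | zero => exact ⟨0, fun a => by simp⟩
    | add b c _ _ ihb ihc =>
      obtain ⟨h, hh⟩ := ihb
      obtain ⟨k, hk⟩ := ihc
      exact ⟨h + k, fun a => by rw [add_mul, map_add, hh, hk, add_mul, map_add]⟩
    | smul c b _ ih =>
      obtain ⟨h, hh⟩ := ih
      exact ⟨c • h, fun a => by rw [smul_mul_assoc, map_smul, hh, smul_mul_assoc, map_smul]⟩
  choose e he using hex
  let E : N →ₗ[ℂ] M :=
    { toFun := e
      map_add' := fun b c => hτ.eq_of_forall_map_mul_eq fun a => by
        rw [add_mul, map_add, he, he, he, add_mul, map_add]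
      map_smul' := fun c b => hτ.eq_of_forall_map_mul_eq fun a => by
        simp only [RingHom.id_apply]
        rw [smul_mul_assoc, map_smul, he, he, smul_mul_assoc, map_smul] }
  have hE : ∀ b a, τ (E b * a) = σ (b * π a) := he
  have hτ' := hτ.isFaithfulTracialState
  have hstar : ∀ b, E (star b) = star (E b) := fun b => by
    refine hτ.eq_of_forall_map_mul_eq fun a => ?_
    rw [hE]
    have h1 : star b * π a = star (star (π a) * b) := by rw [star_mul, star_star]
    have h2 : star (E b) * a = star (star a * E b) := by rw [star_mul, star_star]
    rw [h1, h2, hσ.map_star, hτ'.map_star, hσ.tracial, hτ.tracial, hE, map_star]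
  refine ⟨⟨E, completelyPositive_of_trace τ hτ.nonneg hτ.tracial hτ.faithful E hstar
    fun k X c hX => ?_⟩, ?_, fun x => ?_, fun b => ?_⟩
  · have := hσ.nonneg (CStarMatrix.sum_star_mul_mul_nonneg hX fun i => π (c i))
    simp only [map_sum] at this
    refine this.trans_eq (Finset.sum_congr rfl fun i _ => Finset.sum_congr rfl fun j _ => ?_)
    rw [mul_assoc, hσ.tracial, mul_assoc, mul_assoc, hτ.tracial, mul_assoc, hE, map_mul π, map_star]
  · refine hτ.eq_of_forall_map_mul_eq fun a => ?_
    exact (hE 1 a).trans (by rw [one_mul, one_mul, hπ])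
  · refine hτ.eq_of_forall_map_mul_eq fun a => ?_
    exact (hE (π x) a).trans (by rw [← map_mul, hπ])
  · change l2norm τ (E b) ≤ _
    rcases (l2norm_nonneg τ (E b)).eq_or_lt with h | h
    · rw [← h]; exact l2norm_nonneg _ _
    · have h1 : l2norm τ (E b) ^ 2 ≤ l2norm σ b * l2norm τ (E b) := by
        rw [hτ'.l2norm_sq, hτ.tracial, hE]
        refine (Complex.re_le_norm _).trans ?_
        have h2 := hσ.norm_map_star_mul_le (star b) (π (star (E b)))
        have h3 : l2norm σ (π (star (E b))) = l2norm τ (E b) := by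
          rw [← hτ'.l2norm_star (E b), l2norm, l2norm, ← map_star, ← map_mul, hπ]
        rwa [star_star, hσ.l2norm_star, h3] at h2
      nlinarith

/-- The inclusion of `M` into `B(H)`. -/
noncomputable def inclusion (M : VonNeumannAlgebra H) : M →⋆ₐ[ℂ] (H →L[ℂ] H) :=
  M.toStarSubalgebra.subtype

theorem inclusion_apply (x : M) : M.inclusion x = (x : H →L[ℂ] H) := rfl

/-- From a finite-dimensional ⋆-subalgebra `B` of an algebra containing `M`: unital completely
positive maps `Φ : B(H) → M_n(ℂ)` and `ψ : M_n(ℂ) → M` such that `ψ ∘ Φ` moves `x ∈ M` in 2-norm by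
at most `d x`, the distance from `x` to `B`. The listed properties of `d` express that being close
to `B` is stable under the ⋆-algebra operations. The map `Φ` is defined on all of `B(H)` by
extending the functional that represents the map `M → M_n(ℂ)`; this is Arveson's
extension theorem. -/
theorem IsTrace.exists_approximation (hτ : M.IsTrace τ) (hσ : IsFaithfulTracialState σ)
    (π : M →⋆ₐ[ℂ] N) (hπ : ∀ x, σ (π x) = τ x) (B : StarSubalgebra ℂ N)
    [FiniteDimensional ℂ B] :
    ∃ (n : ℕ) (Φ : (H →L[ℂ] H) →CP CStarMatrix (Fin n) (Fin n) ℂ)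
      (ψ : CStarMatrix (Fin n) (Fin n) ℂ →CP M) (d : M → ℝ),
      Φ 1 = 1 ∧ ψ 1 = 1 ∧ (∀ x, 0 ≤ d x) ∧ (∀ x y, d (x + y) ≤ d x + d y) ∧
      (∀ (c : ℂ) x, d (c • x) ≤ ‖c‖ * d x) ∧ (∀ x, d (star x) ≤ d x) ∧
      (∀ x y, d (x * y) ≤ ‖x‖ * d y + d x * ‖y‖) ∧
      (∀ x, ∀ b ∈ B, d x ≤ l2norm σ (π x - b)) ∧
      ∀ x : M, l2norm τ (ψ (Φ x) - x) ≤ d x := by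
  obtain ⟨n, s, hs, ψ, E, hφ1, hψ1, hψφ, hEB, hEbest⟩ := hσ.exists_factorization B
  obtain ⟨P, hP1, hPπ, hPnorm⟩ := hτ.exists_conditionalExpectation hσ π hπ
  let πn : CStarMatrix (Fin n) (Fin n) M →⋆ₙₐ[ℂ] CStarMatrix (Fin n) (Fin n) N :=
    CStarMatrix.mapₙₐ (π : M →⋆ₙₐ[ℂ] N)
  let jn : CStarMatrix (Fin n) (Fin n) M →⋆ₙₐ[ℂ] CStarMatrix (Fin n) (Fin n) (H →L[ℂ] H) :=
    CStarMatrix.mapₙₐ (M.inclusion : M →⋆ₙₐ[ℂ] (H →L[ℂ] H))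
  obtain ⟨s', hs', hext⟩ := exists_nonneg_extension jn
    (fun X Y h => CStarMatrix.ext fun i j => Subtype.ext <|
      congrArg (fun Z : CStarMatrix (Fin n) (Fin n) (H →L[ℂ] H) => Z i j) h)
    (CStarMatrix.ext fun i j => by
      change M.inclusion ((1 : CStarMatrix (Fin n) (Fin n) M) i j) = _
      rw [CStarMatrix.one_apply, CStarMatrix.one_apply]
      split_ifs <;> simp)
    (s ∘ₗ (πn : CStarMatrix (Fin n) (Fin n) M →ₗ[ℂ] CStarMatrix (Fin n) (Fin n) N))
    (fun X hX => hs _ (map_nonneg πn hX))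
  have hΦ : ∀ x : M, CStarMatrix.ofFunctional s' hs' (x : H →L[ℂ] H)
      = CStarMatrix.ofFunctional s hs (π x) := by
    intro x
    ext i k
    have e1 : jn (CStarMatrix.entry i k x) = CStarMatrix.entry i k (x : H →L[ℂ] H) := by
      refine CStarMatrix.ext fun a b => ?_
      change M.inclusion (CStarMatrix.entry i k x a b) = _
      rw [CStarMatrix.entry_apply, CStarMatrix.entry_apply]
      split_ifs <;> simp [inclusion_apply]
    have e2 : πn (CStarMatrix.entry i k x) = CStarMatrix.entry i k (π x) := by
      refine CStarMatrix.ext fun a b => ?_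
      change π (CStarMatrix.entry i k x a b) = _
      rw [CStarMatrix.entry_apply, CStarMatrix.entry_apply]
      split_ifs <;> simp
    rw [CStarMatrix.ofFunctional_apply, CStarMatrix.ofFunctional_apply, ← e1, hext, ← e2]
    rfl
  -- As a composition `G` of unital completely positive maps, `E` is ⋆-preserving and contractive.
  let G : N →CP N := ψ.comp (CStarMatrix.ofFunctional s hs)
  have hG : ∀ y, G y = E y := hψφ
  have hG1 : G 1 = 1 := by rw [CompletelyPositiveMap.comp_apply, hφ1, hψ1]
  refine ⟨n, CStarMatrix.ofFunctional s' hs', P.comp ψ, fun x => l2norm σ (π x - E (π x)), ?_, ?_,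
    fun x => l2norm_nonneg _ _, fun x y => ?_, fun c x => ?_, fun x => ?_, fun x y => ?_,
    fun x b hb => hEbest _ b hb, fun x => ?_⟩
  · have := hΦ 1
    rw [_root_.map_one π, hφ1] at this
    exact this
  · rw [CompletelyPositiveMap.comp_apply, hψ1, hP1]
  · dsimp only
    refine le_of_eq_of_le ?_ (hσ.l2norm_add_le _ _)
    congr 1
    simp only [map_add]
    abel
  · dsimp only
    refine le_of_eq ?_
    rw [← hσ.l2norm_smul, map_smul, map_smul, smul_sub]
  · dsimp only
    refine le_of_eq ?_
    rw [← hσ.l2norm_star (π x - E (π x)), star_sub, map_star, ← hG, ← hG, G.map_star]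
  -- The product `E(π x) E(π y)` is in `B`, hence a competitor for the distance of `π (x y)` to `B`.
  · refine (hEbest _ _ (mul_mem (hEB (π x)) (hEB (π y)))).trans ?_
    have e : π (x * y) - E (π x) * E (π y)
        = π x * (π y - E (π y)) + (π x - E (π x)) * E (π y) := by
      rw [map_mul]; noncomm_ring
    rw [e]
    refine (hσ.l2norm_add_le _ _).trans (add_le_add ?_ ?_)
    · refine (hσ.l2norm_mul_le _ _).trans ?_
      gcongr
      · exact l2norm_nonneg _ _
      · exact NonUnitalStarAlgHom.norm_apply_le π x
    · refine (hσ.l2norm_mul_le' _ _).trans ?_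
      gcongr
      · exact l2norm_nonneg _ _
      · rw [← hG]
        exact (G.norm_apply_le hG1 _).trans (NonUnitalStarAlgHom.norm_apply_le π y)
  · dsimp only
    rw [hΦ, CompletelyPositiveMap.comp_apply, hψφ]
    have e : P (E (π x)) - x = P (E (π x) - π x) := by rw [map_sub, hPπ]
    rw [e, ← l2norm_neg σ, neg_sub]
    exact hPnorm _

end Approximation

end VonNeumannAlgebra

/-! ### Semidiscreteness and amenability -/

namespace VonNeumannAlgebra

variable {H : Type*} [NormedAddCommGroup H] [InnerProductSpace ℂ H] [CompleteSpace H]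
  {M : VonNeumannAlgebra H} {τ : M →ₗ[ℂ] ℂ}

/-- If the distances `d k x` tend to zero on the generators, they do so everywhere: by the stability
properties, on the generated ⋆-algebra, and then on its 2-norm closure, since `d k` is dominated by
the 2-norm. -/
theorem IsTrace.tendsto_zero_of_generators (hτ : M.IsTrace τ) {F : Set M}
    (hgen : M.IsGeneratedBy F) (d : ℕ → M → ℝ) (hd0 : ∀ k x, 0 ≤ d k x)
    (hadd : ∀ k x y, d k (x + y) ≤ d k x + d k y)
    (hsmul : ∀ k (c : ℂ) x, d k (c • x) ≤ ‖c‖ * d k x) (hstar : ∀ k x, d k (star x) ≤ d k x)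
    (hmul : ∀ k x y, d k (x * y) ≤ ‖x‖ * d k y + d k x * ‖y‖)
    (hle : ∀ k x, d k x ≤ l2norm τ x) (hone : ∀ k, d k 1 = 0)
    (hF : ∀ x ∈ F, Tendsto (fun k => d k x) atTop (𝓝 0)) (x : M) :
    Tendsto (fun k => d k x) atTop (𝓝 0) := by
  have hadj : ∀ a ∈ StarAlgebra.adjoin ℂ F, Tendsto (fun k => d k a) atTop (𝓝 0) := by
    intro a ha
    induction ha using StarAlgebra.adjoin_induction with
    | mem a ha => exact hF a ha
    | algebraMap r =>
      refine squeeze_zero (hd0 · _) (fun k => ?_) tendsto_const_nhds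
      rw [Algebra.algebraMap_eq_smul_one]
      exact (hsmul k r 1).trans_eq (by rw [hone, mul_zero])
    | add a b _ _ iha ihb =>
      exact squeeze_zero (hd0 · _) (hadd · a b) (by simpa using iha.add ihb)
    | mul a b _ _ iha ihb =>
      exact squeeze_zero (hd0 · _) (hmul · a b)
        (by simpa using (ihb.const_mul ‖a‖).add (iha.mul_const ‖b‖))
    | star a _ iha => exact squeeze_zero (hd0 · _) (hstar · a) iha
  rw [Metric.tendsto_atTop]
  intro ε hε
  obtain ⟨a, ha, hxa⟩ := hτ.exists_adjoin_l2norm_sub_lt hgen x (half_pos hε)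
  obtain ⟨k₀, hk₀⟩ := Metric.tendsto_atTop.1 (hadj a ha) (ε / 2) (half_pos hε)
  refine ⟨k₀, fun k hk => ?_⟩
  have h1 := hk₀ k hk
  rw [Real.dist_0_eq_abs, abs_of_nonneg (hd0 _ _)] at h1 ⊢
  have h2 := hadd k (x - a) a
  rw [sub_add_cancel] at h2
  linarith [hle k (x - a)]

/-- A sequence of contractions `B(H) → M` that converges `σ`-weakly to the identity on `M` has, by
compactness, a limit on all of `B(H)` along an ultrafilter, and this limit is a projection onto
`M`. -/
theorem isAmenable_of_tendsto (E : ℕ → (H →L[ℂ] H) →ₗ[ℂ] M) (hE : ∀ k x, ‖E k x‖ ≤ ‖x‖)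
    (hlim : ∀ x : M, M.TendstoSigmaWeak (fun k => E k x) atTop x) : M.IsAmenable := by
  have hU : ((hyperfilter ℕ : Ultrafilter ℕ) : Filter ℕ) ≤ atTop := by
    rw [← Nat.cofinite_eq_atTop]; exact hyperfilter_le_cofinite
  choose P hP hPlim using fun x : H →L[ℂ] H =>
    exists_ultrafilter_inner_limit (hyperfilter ℕ) (fun k => (E k x : H →L[ℂ] H))
      (norm_nonneg x) (fun k => hE k x)
  have huniq : ∀ (x y : H →L[ℂ] H), (∀ ξ η, Tendsto (fun k => ⟪ξ, (E k x : H →L[ℂ] H) η⟫_ℂ)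
      (hyperfilter ℕ : Ultrafilter ℕ) (𝓝 ⟪ξ, y η⟫_ℂ)) → P x = y := fun x y h => by
    ext η
    exact ext_inner_left ℂ fun ξ => tendsto_nhds_unique (hPlim x ξ η) (h ξ η)
  refine ⟨{ toFun := P
            map_add' := fun x y => huniq _ _ fun ξ η => ?_
            map_smul' := fun c x => huniq _ _ fun ξ η => ?_ },
    fun x => M.mem_of_tendsto_inner (fun k => (E k x).2) (hPlim x), fun x hx => ?_, hP⟩
  · simpa [inner_add_right] using (hPlim x ξ η).add (hPlim y ξ η)
  · simpa [inner_smul_right] using (hPlim x ξ η).const_mul c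
  · refine huniq _ _ fun ξ η => ?_
    obtain ⟨f, hf, hfx⟩ := M.exists_isNormalFunctional_inner ξ η
    have := (hlim ⟨x, hx⟩ f hf).mono_left hU
    simpa only [hfx] using this

/-- Semidiscreteness from a sequence of maps; the index set is lifted to the universe that
`IsSemidiscrete` asks for. -/
theorem isSemidiscrete_of_tendsto {H : Type u} [NormedAddCommGroup H] [InnerProductSpace ℂ H]
    [CompleteSpace H] {M : VonNeumannAlgebra H} (n : ℕ → ℕ)
    (φ : ∀ k, M →CP CStarMatrix (Fin (n k)) (Fin (n k)) ℂ)
    (ψ : ∀ k, CStarMatrix (Fin (n k)) (Fin (n k)) ℂ →CP M) (hφ : ∀ k, φ k 1 = 1)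
    (hψ : ∀ k, ψ k 1 = 1) (h : ∀ x : M, M.TendstoSigmaWeak (fun k => ψ k (φ k x)) atTop x) :
    M.IsSemidiscrete :=
  have hdown : Tendsto (ULift.down : ULift.{u} ℕ → ℕ) atTop atTop :=
    tendsto_atTop.2 fun b => (eventually_ge_atTop (ULift.up.{u} b)).mono fun _ h => h
  ⟨ULift.{u} ℕ, inferInstance, ⟨fun a b => ⟨⟨max a.down b.down⟩, le_max_left a.down b.down,
    le_max_right a.down b.down⟩⟩, inferInstance, fun j => n j.down, fun j => φ j.down,
    fun j => ψ j.down, fun j => hφ j.down, fun j => hψ j.down,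
    fun x f hf => (h x f hf).comp hdown⟩

end VonNeumannAlgebra

theorem lemma2p6 {H : Type u} [NormedAddCommGroup H] [InnerProductSpace ℂ H]
    [CompleteSpace H] (A : VonNeumannAlgebra H) (τ : A →ₗ[ℂ] ℂ) (hτ : A.IsTrace τ)
    (F : Set A) (hF : F.Finite) (hgen : A.IsGeneratedBy F)
    (happrox : ∀ ε : ℝ, 0 < ε →
      ∃ (K : Type v) (_ : NormedAddCommGroup K) (_ : InnerProductSpace ℂ K) (_ : CompleteSpace K)
        (N : VonNeumannAlgebra K) (σ : N →ₗ[ℂ] ℂ) (π : A →⋆ₐ[ℂ] N) (B : StarSubalgebra ℂ N),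
        N.IsTrace σ ∧ VonNeumannAlgebra.IsTracialEmbedding τ σ π ∧ FiniteDimensional ℂ B ∧
          ∀ x ∈ F, ∃ b ∈ B, VonNeumannAlgebra.twoNorm σ (π x - b) < ε) :
    A.IsSemidiscrete ∧ A.IsAmenable := by
  -- The approximate factorizations for `ε = 1 / (k + 1)`.
  have hpack : ∀ k : ℕ, ∃ (n : ℕ) (Φ : (H →L[ℂ] H) →CP CStarMatrix (Fin n) (Fin n) ℂ)
      (ψ : CStarMatrix (Fin n) (Fin n) ℂ →CP A) (d : A → ℝ),
      Φ 1 = 1 ∧ ψ 1 = 1 ∧ (∀ x, 0 ≤ d x) ∧ (∀ x y, d (x + y) ≤ d x + d y) ∧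
      (∀ (c : ℂ) x, d (c • x) ≤ ‖c‖ * d x) ∧ (∀ x, d (star x) ≤ d x) ∧
      (∀ x y, d (x * y) ≤ ‖x‖ * d y + d x * ‖y‖) ∧ (∀ x, d x ≤ l2norm τ x) ∧ d 1 = 0 ∧
      (∀ x ∈ F, d x ≤ 1 / ((k : ℝ) + 1)) ∧ ∀ x : A, l2norm τ (ψ (Φ x) - x) ≤ d x := by
    intro k
    obtain ⟨K, _, _, _, N, σ, π, B, hσ, hπ, hB, hFB⟩ :=
      happrox (1 / ((k : ℝ) + 1)) (by positivity)
    obtain ⟨n, Φ, ψ, d, h1, h2, h3, h4, h5, h6, h7, h8, h9⟩ :=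
      hτ.exists_approximation hσ.isFaithfulTracialState π hπ.trace_map B
    refine ⟨n, Φ, ψ, d, h1, h2, h3, h4, h5, h6, h7, fun x => ?_, ?_, fun x hx => ?_, h9⟩
    · refine (h8 x 0 (zero_mem B)).trans_eq ?_
      rw [sub_zero, l2norm, l2norm, ← map_star, ← map_mul, hπ.trace_map]
    · refine le_antisymm ((h8 1 1 (one_mem B)).trans_eq ?_) (h3 1)
      rw [map_one, sub_self]
      simp [l2norm]
    · obtain ⟨b, hb, hlt⟩ := hFB x hx
      exact (h8 x b hb).trans hlt.le
  choose n Φ ψ d hΦ1 hψ1 hd0 hadd hsmul hstar hmul hle hone hdF happ using hpack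
  have hd : ∀ x, Tendsto (fun k => d k x) atTop (𝓝 0) :=
    hτ.tendsto_zero_of_generators hgen d hd0 hadd hsmul hstar hmul hle hone fun x hx =>
      squeeze_zero (hd0 · x) (hdF · x hx) tendsto_one_div_add_atTop_nhds_zero_nat
  have hnorm : ∀ k x, ‖ψ k (Φ k x)‖ ≤ ‖x‖ := fun k =>
    ((ψ k).comp (Φ k)).norm_apply_le (by rw [CompletelyPositiveMap.comp_apply, hΦ1, hψ1])
  have hlim : ∀ x : A, A.TendstoSigmaWeak (fun k => ψ k (Φ k x)) atTop x := by
    intro x f hf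
    rw [← tendsto_sub_nhds_zero_iff]
    have := hτ.tendsto_of_l2norm (x := fun k => ψ k (Φ k x) - x) (R := ‖x‖ + ‖x‖)
      (fun k => (norm_sub_le _ _).trans (add_le_add (hnorm k x) le_rfl))
      (squeeze_zero (fun k => l2norm_nonneg _ _) (happ · x) (hd x)) hf
    simpa only [map_sub] using this
  let ι : A →CP (H →L[ℂ] H) := CompletelyPositiveMapClass.toCompletelyPositiveLinearMap A.inclusion
  exact ⟨VonNeumannAlgebra.isSemidiscrete_of_tendsto n (fun k => (Φ k).comp ι) ψ hΦ1 hψ1 hlim,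
    VonNeumannAlgebra.isAmenable_of_tendsto (fun k => ((ψ k).comp (Φ k)).toLinearMap) hnorm hlim⟩
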